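/- Let $L$ be the first-order language (with equality) of Boolean algebras, with symbols $0,1,\cap,\cup,\neg$, enriched by unary predicates $C_n$ for all integers $n\ge 1$. A Boolean algebra is regarded as an $L$-structure by interpreting $C_n(x)$ as "there are at least $n$ distinct atoms $\alpha$ with $\alpha\le x$". Let $T$ be the theory of infinite atomic Boolean algebras in $L$, that is, the set of all $L$-sentences true in every infinite atomic Boolean algebra. Then: 1. $T$ is complete: it is satisfiable, and for every $L$-sentence $\varphi$, either $\varphi$ or $\neg\varphi$ follows from $T$. 2. $T$ is decidable: the set of Gödel numbers of the $L$-sentences that follow from $T$ is computable. 3. $T$ has quantifier elimination: every $L$-formula is equivalent modulo $T$ to a quantifier-free $L$-formula in the same free variables. 4. $T$ is axiomatized by the axioms of Boolean algebras, the sentences "there are at least $n$ elements" for all $n$, the sentence "every nonzero element has an atom below it", and for each $n\ge1$ the sentence stating the intended meaning of $C_n$ ("$C_n(x)$ holds if and only if there are $n$ distinct atoms below $x$"): the consequences of these axioms are exactly the consequences of $T$, and the models of these axioms are exactly the infinite atomic Boolean algebras with $C_n$ interpreted as above. -/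

import Mathlib

open FirstOrder FirstOrder.Language

universe u

namespace BoolAtoms

/-- Function symbols of the Boolean language: `0`, `1`, complement, `∩`, `∪`. -/
inductive Func : ℕ → Type
  | zero : Func 0
  | one : Func 0
  | compl : Func 1
  | inf : Func 2
  | sup : Func 2

/-- The enriching predicates: one unary predicate `C n` for every integer `n ≥ 1`. -/
inductive Rel : ℕ → Type
  | C (n : ℕ+) : Rel 1

/-- The Boolean language enriched by all the predicates `C n`. -/
abbrev L : Language := ⟨Func, Rel⟩

/-- A Boolean algebra as a structure for the enriched language: the Boolean symbols are the
Boolean operations, and `C n` holds of `x` iff there are at least `n` distinct atoms below `x`. -/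
abbrev structureOf (B : Type*) [BooleanAlgebra B] : L.Structure B where
  funMap {_} f v :=
    match f, v with
    | Func.zero, _ => ⊥
    | Func.one, _ => ⊤
    | Func.compl, v => (v 0)ᶜ
    | Func.inf, v => v 0 ⊓ v 1
    | Func.sup, v => v 0 ⊔ v 1
  RelMap {_} r v :=
    match r, v with
    | Rel.C n, v => ((n : ℕ) : ℕ∞) ≤ Set.encard {a : B | IsAtom a ∧ a ≤ v 0}

/-- The theory of infinite atomic Boolean algebras in the enriched language: all sentences that
are true in every infinite atomic Boolean algebra. -/
def theoryInfAtomic : L.Theory :=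
  {φ | ∀ (B : Type u) [BooleanAlgebra B] [Infinite B] [IsAtomic B],
    @Sentence.Realize L B (structureOf B) φ}

/-! ### The axioms -/

section Axioms

variable {α : Type}

/-- The term `0`. -/
def tZero : L.Term α := Term.func Func.zero ![]

/-- The term `1`. -/
def tOne : L.Term α := Term.func Func.one ![]

/-- The term `¬ t`. -/
def tCompl (t : L.Term α) : L.Term α := Term.func Func.compl ![t]

/-- The term `s ∩ t`. -/
def tInf (s t : L.Term α) : L.Term α := Term.func Func.inf ![s, t]

/-- The term `s ∪ t`. -/
def tSup (s t : L.Term α) : L.Term α := Term.func Func.sup ![s, t]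

end Axioms

/-- The variable `i` of a formula with `m` bound variables in scope. -/
abbrev tVar {m : ℕ} (i : Fin m) : L.Term (Empty ⊕ Fin m) := Term.var (Sum.inr i)

/-- The axioms of Boolean algebras (complemented distributive lattices). -/
def axiomsBoolean : L.Theory :=
  let x : L.Term (Empty ⊕ Fin 3) := tVar 0
  let y : L.Term (Empty ⊕ Fin 3) := tVar 1
  let z : L.Term (Empty ⊕ Fin 3) := tVar 2
  { ∀' ∀' ∀' ((tInf x y).bdEqual (tInf y x)),
    ∀' ∀' ∀' ((tSup x y).bdEqual (tSup y x)),
    ∀' ∀' ∀' ((tInf (tInf x y) z).bdEqual (tInf x (tInf y z))),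
    ∀' ∀' ∀' ((tSup (tSup x y) z).bdEqual (tSup x (tSup y z))),
    ∀' ∀' ∀' ((tInf x (tSup x y)).bdEqual x),
    ∀' ∀' ∀' ((tSup x (tInf x y)).bdEqual x),
    ∀' ∀' ∀' ((tInf x (tSup y z)).bdEqual (tSup (tInf x y) (tInf x z))),
    ∀' ∀' ∀' ((tSup x (tInf y z)).bdEqual (tInf (tSup x y) (tSup x z))),
    ∀' ∀' ∀' ((tInf x (tCompl x)).bdEqual tZero),
    ∀' ∀' ∀' ((tSup x (tCompl x)).bdEqual tOne) }

/-- The formula `s ≤ t`, that is, `s ∩ t = s`. -/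
def fLe {m : ℕ} (s t : L.Term (Empty ⊕ Fin m)) : L.BoundedFormula Empty m :=
  (tInf s t).bdEqual s

/-- The formula saying that the variable `i` is an atom: it is not `0`, and every `b` below it is
`0` or equal to it. -/
def fAtom {m : ℕ} (i : Fin m) : L.BoundedFormula Empty m :=
  ∼((tVar i).bdEqual tZero) ⊓
    ∀' (fLe (tVar (Fin.last m)) (tVar i.castSucc) ⟹
      ((tVar (Fin.last m)).bdEqual tZero ⊔ (tVar (Fin.last m)).bdEqual (tVar i.castSucc)))

/-- Every nonzero element has an atom below it. -/
def axiomAtomic : L.Sentence :=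
  ∀' (∼((tVar (0 : Fin 1)).bdEqual tZero) ⟹
    ∃' (fAtom (1 : Fin 2) ⊓ fLe (tVar (1 : Fin 2)) (tVar 0)))

/-- Existential quantification over the last `n` bound variables. -/
def exsLast {m : ℕ} : (n : ℕ) → L.BoundedFormula Empty (m + n) → L.BoundedFormula Empty m
  | 0, φ => φ
  | n + 1, φ => exsLast n φ.ex

/-- The sentence giving `C n` its meaning: for every `x`, `C n` holds of `x` iff there are
pairwise distinct atoms `y₁, …, yₙ` below `x`. -/
noncomputable def axiomC (n : ℕ+) : L.Sentence :=
  ∀' ((BoundedFormula.rel (Rel.C n) ![tVar (0 : Fin 1)]).iff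
    (exsLast (m := 1) (n : ℕ)
      ((BoundedFormula.iInf fun i : Fin n =>
          fAtom (Fin.natAdd 1 i) ⊓ fLe (tVar (Fin.natAdd 1 i)) (tVar (Fin.castAdd n 0))) ⊓
        BoundedFormula.iInf fun p : {p : Fin n × Fin n // p.1 ≠ p.2} =>
          ∼((tVar (Fin.natAdd 1 p.1.1)).bdEqual (tVar (Fin.natAdd 1 p.1.2))))))

/-- The axioms: the models are infinite Boolean algebras, every nonzero element has an atom below
it, and the predicates `C n` have their intended meaning. -/
noncomputable def axiomsInfAtomic : L.Theory :=
  axiomsBoolean ∪ L.infiniteTheory ∪ {axiomAtomic} ∪ Set.range axiomC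

/-! ### Axiomatization, quantifier elimination, decidability -/

/-- `T` is axiomatized by `A`: the two have the same consequences. -/
def IsAxiomatizedBy (T A : L.Theory) : Prop :=
  ∀ φ : L.Sentence, T ⊨ᵇ φ ↔ A ⊨ᵇ φ

/-- `T` has quantifier elimination: modulo `T`, every formula is equivalent to a quantifier-free
formula in the same free variables. -/
def HasQuantifierElimination (T : L.Theory) : Prop :=
  ∀ (n : ℕ) (φ : L.Formula (Fin n)), ∃ ψ : L.Formula (Fin n), ψ.IsQF ∧ φ ⇔[T] ψ

/-- Gödel numbers of terms. -/
def termCode {m : ℕ} : L.Term (Empty ⊕ Fin m) → ℕ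
  | .var (.inl e) => e.elim
  | .var (.inr i) => Nat.pair 0 i
  | .func Func.zero _ => Nat.pair 1 0
  | .func Func.one _ => Nat.pair 2 0
  | .func Func.compl ts => Nat.pair 3 (termCode (ts 0))
  | .func Func.inf ts => Nat.pair 4 (Nat.pair (termCode (ts 0)) (termCode (ts 1)))
  | .func Func.sup ts => Nat.pair 5 (Nat.pair (termCode (ts 0)) (termCode (ts 1)))

/-- Gödel numbers of formulas. -/
def formulaCode : {m : ℕ} → L.BoundedFormula Empty m → ℕ
  | _, .falsum => Nat.pair 0 0
  | _, .equal s t => Nat.pair 1 (Nat.pair (termCode s) (termCode t))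
  | _, .rel (Rel.C n) ts => Nat.pair 2 (Nat.pair n (termCode (ts 0)))
  | _, .imp φ ψ => Nat.pair 3 (Nat.pair (formulaCode φ) (formulaCode ψ))
  | _, .all φ => Nat.pair 4 (formulaCode φ)

/-- `T` is decidable: the set of Gödel numbers of the sentences that follow from `T` is
computable. -/
def IsDecidable (T : L.Theory) : Prop :=
  ComputablePred fun c : ℕ => ∃ φ : L.Sentence, formulaCode φ = c ∧ T ⊨ᵇ φ

theorem termCode_injective {m : ℕ} :
    Function.Injective (termCode : L.Term (Empty ⊕ Fin m) → ℕ) := by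
  intro s
  induction s with
  | var a =>
    rcases a with e | i
    · exact e.elim
    · rintro (⟨e | j⟩ | ⟨_ | _ | _ | _ | _, us⟩) h
      · exact e.elim
      all_goals simp_all [termCode, Nat.pair_eq_pair, Fin.ext_iff]
  | func f ts ih =>
    cases f <;> rintro (⟨e | j⟩ | ⟨_ | _ | _ | _ | _, us⟩) h <;> first
      | exact e.elim
      | (simp only [termCode, Nat.pair_eq_pair] at h
         first
          | (exfalso; omega)
          | (congr 1; funext i; fin_cases i <;>
              first
              | exact ih _ h.2
              | exact ih _ h.2.1
              | exact ih _ h.2.2))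

/-- Distinct sentences have distinct Gödel numbers. -/
theorem formulaCode_injective {m : ℕ} :
    Function.Injective (formulaCode : L.BoundedFormula Empty m → ℕ) := by
  intro φ
  induction φ with
  | falsum => rintro (_ | ⟨s, t⟩ | ⟨⟨n⟩, us⟩ | ⟨φ, ψ⟩ | ⟨φ⟩) h <;>
      simp_all [formulaCode, Nat.pair_eq_pair]
  | equal s t => rintro (_ | ⟨s, t⟩ | ⟨⟨n⟩, us⟩ | ⟨φ, ψ⟩ | ⟨φ⟩) h <;>
      simp_all [formulaCode, Nat.pair_eq_pair, termCode_injective.eq_iff]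
  | rel R ts =>
    obtain ⟨k⟩ := R
    rintro (_ | ⟨s, t⟩ | ⟨⟨n⟩, us⟩ | ⟨φ, ψ⟩ | ⟨φ⟩) h
    case rel.rel =>
      simp only [formulaCode, Nat.pair_eq_pair, termCode_injective.eq_iff, PNat.coe_inj] at h
      obtain ⟨-, rfl, h⟩ := h
      congr 1
      funext i
      fin_cases i
      exact h
    all_goals simp_all [formulaCode, Nat.pair_eq_pair]
  | imp φ ψ ihφ ihψ =>
    rintro (_ | ⟨s, t⟩ | ⟨⟨n⟩, us⟩ | ⟨φ', ψ'⟩ | ⟨φ'⟩) h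
    case imp.imp =>
      simp only [formulaCode, Nat.pair_eq_pair] at h
      rw [ihφ h.2.1, ihψ h.2.2]
    all_goals simp_all [formulaCode, Nat.pair_eq_pair]
  | all φ ih =>
    rintro (_ | ⟨s, t⟩ | ⟨⟨n⟩, us⟩ | ⟨φ', ψ'⟩ | ⟨φ'⟩) h
    case all.all =>
      simp only [formulaCode, Nat.pair_eq_pair] at h
      rw [ih h.2]
    all_goals simp_all [formulaCode, Nat.pair_eq_pair]

end BoolAtoms

/-!
A tuple of elements cuts the set of atoms of a Boolean algebra into cells, one for each set of
entries of the tuple. Call two tuples similar up to `K` if corresponding cells have the same number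
of atoms, all numbers that are at least `K` being identified. Tuples that are similar up to `2 * K`
can be extended by further elements so as to be similar up to `K`, because a splitting of a cell can
be copied by a splitting into parts of which one is finite. Hence, in atomic algebras, the truncated
cell sizes, with a precision that doubles at each quantifier, determine whether a formula holds.
They are expressed by the quantifier-free formulas `C n t`, which gives quantifier elimination, and
completeness follows because an infinite atomic algebra has infinitely many atoms. In the same way a
sentence cannot distinguish an infinite atomic algebra from a sufficiently large finite power set
algebra, and there its truth value can be computed.
-/

namespace BoolAtoms

/-! ### Atoms -/

section Atoms

variable {B : Type*} [BooleanAlgebra B] {a x y : B}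

theorem le_sup_iff_of_isAtom (ha : IsAtom a) : a ≤ x ⊔ y ↔ a ≤ x ∨ a ≤ y := by
  refine ⟨fun h => or_iff_not_imp_left.2 fun hx => ?_,
    fun h => h.elim le_sup_of_le_left le_sup_of_le_right⟩
  exact (ha.not_le_iff_disjoint.1 hx).left_le_of_le_sup_left h

theorem le_compl_iff_of_isAtom (ha : IsAtom a) : a ≤ xᶜ ↔ ¬ a ≤ x := by
  rw [le_compl_iff_disjoint_right, ha.not_le_iff_disjoint]

theorem le_finset_sup_iff_of_isAtom {ι : Type*} (ha : IsAtom a) (s : Finset ι) (f : ι → B) :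
    a ≤ s.sup f ↔ ∃ i ∈ s, a ≤ f i := by
  induction s using Finset.cons_induction with
  | empty => simpa using ha.1
  | cons i s _ ih => simp [le_sup_iff_of_isAtom ha, ih]

/-- The set of atoms below an element, whose cardinality the predicates `C n` measure. -/
def atomsBelow (x : B) : Set B := {a | IsAtom a ∧ a ≤ x}

theorem atomsBelow_sdiff : atomsBelow (x \ y) = atomsBelow x \ atomsBelow y := by
  ext a
  by_cases ha : IsAtom a <;> simp [atomsBelow, ha, sdiff_eq, le_compl_iff_of_isAtom]

theorem atomsBelow_injective [IsAtomic B] : Function.Injective (atomsBelow : B → Set B) := by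
  intro x y h
  refine BooleanAlgebra.eq_iff_atom_le_iff.2 fun a ha => ?_
  simpa [atomsBelow, ha] using Set.ext_iff.1 h a

theorem exists_atomsBelow_eq_of_finite {A : Set B} (hA : A.Finite) (hatom : ∀ a ∈ A, IsAtom a) :
    ∃ y : B, atomsBelow y = A := by
  refine ⟨hA.toFinset.sup id, Set.ext fun a => ⟨?_, fun ha => ⟨hatom a ha, ?_⟩⟩⟩
  · rintro ⟨ha, hle⟩
    obtain ⟨b, hb, hab⟩ := (le_finset_sup_iff_of_isAtom ha _ _).1 hle
    have hbA : b ∈ A := hA.mem_toFinset.1 hb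
    rwa [((hatom b hbA).le_iff_eq ha.1).1 hab]
  · exact Finset.le_sup (f := id) (hA.mem_toFinset.2 ha)

theorem exists_atomsBelow_eq {A : Set B} (hsub : A ⊆ atomsBelow x)
    (hA : A.Finite ∨ (atomsBelow x \ A).Finite) : ∃ y : B, atomsBelow y = A := by
  rcases hA with hA | hA
  · exact exists_atomsBelow_eq_of_finite hA fun a ha => (hsub ha).1
  · obtain ⟨y, hy⟩ := exists_atomsBelow_eq_of_finite hA fun a ha => ha.1.1
    exact ⟨x \ y, by rw [atomsBelow_sdiff, hy, Set.sdiff_sdiff_cancel_left hsub]⟩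

theorem encard_isAtom_eq_top [IsAtomic B] [Infinite B] : {a : B | IsAtom a}.encard = ⊤ := by
  refine Set.encard_eq_top_iff.2 fun hfin => ?_
  exact Set.infinite_range_of_injective atomsBelow_injective
    (hfin.finite_subsets.subset (Set.range_subset_iff.2 fun x a ha => ha.1))

theorem atomsBelow_set {X : Type*} (s : Set X) : atomsBelow s = singleton '' s := by
  ext a
  simp only [atomsBelow, Set.isAtom_iff, Set.mem_image]
  constructor
  · rintro ⟨⟨x, rfl⟩, h⟩
    exact ⟨x, by simpa using h, rfl⟩
  · rintro ⟨x, hx, rfl⟩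
    exact ⟨⟨x, rfl⟩, by simpa using hx⟩

theorem encard_atomsBelow_set {X : Type*} (s : Set X) : (atomsBelow s).encard = s.encard := by
  rw [atomsBelow_set, Set.singleton_injective.encard_image]

end Atoms

/-! ### Truncated counting -/

section EqUpTo

/-- Two cardinalities are equal up to `K` if they agree once every cardinality that is at least `K`
is identified with `K`. -/
def EqUpTo (K : ℕ) (x y : ℕ∞) : Prop := x = y ∨ (K : ℕ∞) ≤ x ∧ (K : ℕ∞) ≤ y

variable {K M : ℕ} {x x' y y' : ℕ∞}

theorem EqUpTo.symm (h : EqUpTo K x y) : EqUpTo K y x := h.imp Eq.symm And.symm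

theorem EqUpTo.mono (hKM : K ≤ M) (h : EqUpTo M x y) : EqUpTo K x y :=
  have hKM : (K : ℕ∞) ≤ M := Nat.cast_le.2 hKM
  h.imp_right (And.imp hKM.trans hKM.trans)

theorem EqUpTo.le_iff {k : ℕ} (h : EqUpTo K x y) (hk : k ≤ K) : (k : ℕ∞) ≤ x ↔ (k : ℕ∞) ≤ y := by
  rcases h.mono hk with rfl | ⟨hx, hy⟩
  · rfl
  · exact iff_of_true hx hy

theorem EqUpTo.of_forall_lt (h : ∀ k < K, ((k + 1 : ℕ) : ℕ∞) ≤ x ↔ ((k + 1 : ℕ) : ℕ∞) ≤ y) :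
    EqUpTo K x y := by
  have min_eq : min x K = min y K := by
    refine ENat.eq_of_forall_natCast_le_iff fun k => ?_
    rw [le_min_iff, le_min_iff, Nat.cast_le]
    refine and_congr_left fun hk => ?_
    cases k with
    | zero => simp
    | succ k => exact h k hk
  rcases min_choice x K with hx | hx <;> rcases min_choice y K with hy | hy <;> grind [EqUpTo]

theorem EqUpTo.add (h : EqUpTo K x y) (h' : EqUpTo K x' y') : EqUpTo K (x + x') (y + y') := by
  rcases h with rfl | ⟨hx, hy⟩
  · rcases h' with rfl | ⟨hx', hy'⟩
    · exact .inl rfl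
    · exact .inr ⟨le_add_left hx', le_add_left hy'⟩
  · exact .inr ⟨le_add_right hx, le_add_right hy⟩

theorem EqUpTo.sum {ι : Type*} {s : Finset ι} {f g : ι → ℕ∞} (h : ∀ i ∈ s, EqUpTo K (f i) (g i)) :
    EqUpTo K (∑ i ∈ s, f i) (∑ i ∈ s, g i) := by
  induction s using Finset.cons_induction with
  | empty => exact .inl rfl
  | cons i s _ ih =>
    simp only [Finset.sum_cons, Finset.forall_mem_cons] at h ⊢
    exact h.1.add (ih h.2)

theorem EqUpTo.exists_add_eq_of_le (hx' : (K : ℕ∞) ≤ x') (hy : (K + K : ℕ∞) ≤ y) :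
    ∃ z z', z + z' = y ∧ EqUpTo K x z ∧ EqUpTo K x' z' ∧ z ≠ ⊤ := by
  have hz : min x K ≤ K := min_le_right x _
  have hfin : min x K ≠ ⊤ := (hz.trans_lt (ENat.natCast_lt_top K)).ne
  refine ⟨min x K, y - min x K, ?_, ?_, .inr ⟨hx', ?_⟩, hfin⟩
  · exact add_tsub_cancel_of_le (hz.trans (le_self_add.trans hy))
  · rcases le_total x K with h | h
    · exact .inl (min_eq_left h).symm
    · exact .inr ⟨h, (min_eq_right h).ge⟩
  · exact ENat.le_sub_of_add_le_left hfin ((add_le_add_left hz _).trans hy)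

/-- Doubling the precision leaves room to follow any splitting of `x + x'`: a part smaller than `K`
is copied exactly, and if neither is, one part may be taken to be `K`. -/
theorem EqUpTo.exists_add_eq (h : EqUpTo (2 * K) (x + x') y) :
    ∃ z z', z + z' = y ∧ EqUpTo K x z ∧ EqUpTo K x' z' ∧ (z ≠ ⊤ ∨ z' ≠ ⊤) := by
  rcases h with rfl | ⟨hx, hy⟩
  · by_cases hfin : x ≠ ⊤ ∨ x' ≠ ⊤
    · exact ⟨x, x', rfl, .inl rfl, .inl rfl, hfin⟩
    · obtain ⟨rfl, rfl⟩ : x = ⊤ ∧ x' = ⊤ := by simpa using hfin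
      exact ⟨K, ⊤, by simp, .inr (by simp), .inl rfl, by simp⟩
  · rw [two_mul, Nat.cast_add] at hx hy
    have hor : (K : ℕ∞) ≤ x ∨ (K : ℕ∞) ≤ x' := by
      by_contra! hlt
      exact hx.not_gt (ENat.add_lt_add hlt.1 hlt.2)
    rcases hor with hx | hx
    · obtain ⟨z', z, hz, hx', hx, hfin⟩ := exists_add_eq_of_le (x := x') hx hy
      exact ⟨z, z', (add_comm z z').trans hz, hx, hx', .inr hfin⟩
    · obtain ⟨z, z', hz, hx, hx', hfin⟩ := exists_add_eq_of_le (x := x) hx hy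
      exact ⟨z, z', hz, hx, hx', .inl hfin⟩

theorem exists_subset_encard_eq_and_encard_sdiff_eq {X : Type*} {Q : Set X} (h : x + y = Q.encard)
    (hfin : x ≠ ⊤ ∨ y ≠ ⊤) : ∃ D ⊆ Q, D.encard = x ∧ (Q \ D).encard = y := by
  have choose_finite {x y : ℕ∞} (h : x + y = Q.encard) (hx : x ≠ ⊤) :
      ∃ D ⊆ Q, D.encard = x ∧ (Q \ D).encard = y := by
    obtain ⟨D, hD, rfl⟩ := Set.exists_subset_encard_eq (h ▸ le_self_add : x ≤ Q.encard)
    refine ⟨D, hD, rfl, ?_⟩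
    rw [← Set.encard_sdiff_add_encard_of_subset hD, add_comm] at h
    exact (ENat.add_left_injective_of_ne_top hx h).symm
  rcases hfin with hx | hy
  · exact choose_finite h hx
  · obtain ⟨D, hD, hDy, hDx⟩ := choose_finite ((add_comm y x).trans h) hy
    exact ⟨Q \ D, Set.sdiff_subset, hDx, by rwa [Set.sdiff_sdiff_cancel_left hD]⟩

theorem EqUpTo.exists_subset {X Y : Type*} {P A : Set X} {Q : Set Y}
    (h : EqUpTo (2 * K) P.encard Q.encard) (hA : A ⊆ P) :
    ∃ D ⊆ Q, (D.Finite ∨ (Q \ D).Finite) ∧ EqUpTo K A.encard D.encard ∧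
      EqUpTo K (P \ A).encard (Q \ D).encard := by
  rw [← Set.encard_sdiff_add_encard_of_subset hA, add_comm] at h
  obtain ⟨x, y, hxy, hx, hy, hfin⟩ := h.exists_add_eq
  obtain ⟨D, hD, rfl, rfl⟩ := exists_subset_encard_eq_and_encard_sdiff_eq hxy hfin
  simp only [ne_eq, Set.encard_eq_top_iff, Set.not_infinite] at hfin
  exact ⟨D, hD, hfin, hx, hy⟩

end EqUpTo

/-! ### Boolean algebras as structures -/

/-- The laws of a complemented distributive lattice for arbitrary operations on a type, in the order
in which `axiomsBoolean` lists them. -/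
structure BooleanLaws {M : Type*} (inf sup : M → M → M) (compl : M → M) (zero one : M) : Prop where
  inf_comm : ∀ x y, inf x y = inf y x
  sup_comm : ∀ x y, sup x y = sup y x
  inf_assoc : ∀ x y z, inf (inf x y) z = inf x (inf y z)
  sup_assoc : ∀ x y z, sup (sup x y) z = sup x (sup y z)
  inf_sup_self : ∀ x y, inf x (sup x y) = x
  sup_inf_self : ∀ x y, sup x (inf x y) = x
  inf_sup_left : ∀ x y z, inf x (sup y z) = sup (inf x y) (inf x z)
  sup_inf_left : ∀ x y z, sup x (inf y z) = inf (sup x y) (sup x z)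
  inf_compl : ∀ x, inf x (compl x) = zero
  sup_compl : ∀ x, sup x (compl x) = one

theorem booleanLaws_of_booleanAlgebra (B : Type*) [BooleanAlgebra B] :
    BooleanLaws (M := B) (· ⊓ ·) (· ⊔ ·) compl ⊥ ⊤ :=
  ⟨inf_comm, sup_comm, inf_assoc, sup_assoc, fun _ _ => inf_sup_self, fun _ _ => sup_inf_self,
    inf_sup_left, sup_inf_left, inf_compl_self, fun _ => sup_compl_eq_top⟩

/-- The Boolean algebra with given operations that satisfy the laws. -/
abbrev BooleanLaws.toBooleanAlgebra {M : Type*} {inf sup : M → M → M} {compl : M → M}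
    {zero one : M} (h : BooleanLaws inf sup compl zero one) : BooleanAlgebra M :=
  let _ : Lattice M := @Lattice.mk' M ⟨sup⟩ ⟨inf⟩
    h.sup_comm h.sup_assoc h.inf_comm h.inf_assoc h.sup_inf_self h.inf_sup_self
  { DistribLattice.ofInfSupLe fun x y z => (h.inf_sup_left x y z).le with
    compl := compl
    bot := zero
    top := one
    bot_le := fun x => (h.inf_compl x).symm.trans_le inf_le_left
    le_top := fun x => le_sup_left.trans_eq (h.sup_compl x)
    inf_compl_le_bot := fun x => (h.inf_compl x).le
    top_le_sup_compl := fun x => (h.sup_compl x).ge }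

/-- A structure on a Boolean algebra whose function symbols denote the Boolean operations; the
predicates `C n` are unconstrained. -/
class IsBooleanStructure (M : Type*) [BooleanAlgebra M] [L.Structure M] : Prop where
  funMap_eq {n : ℕ} (f : L.Functions n) (v : Fin n → M) :
    Structure.funMap f v = (structureOf M).funMap f v

instance (B : Type*) [BooleanAlgebra B] :
    letI := structureOf B
    IsBooleanStructure B :=
  letI := structureOf B
  ⟨fun _ _ => rfl⟩

section BooleanModels

variable {M : Type*} [L.Structure M]

theorem model_axiomsBoolean_iff :
    M ⊨ axiomsBoolean ↔
      BooleanLaws (M := M) (fun x y => Structure.funMap (L := L) Func.inf ![x, y])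
        (fun x y => Structure.funMap (L := L) Func.sup ![x, y])
        (fun x => Structure.funMap (L := L) Func.compl ![x])
        (Structure.funMap (L := L) Func.zero ![]) (Structure.funMap (L := L) Func.one ![]) := by
  have realize_nullary (f : L.Functions 0) (v : Empty ⊕ Fin 3 → M) :
      (Term.func f ![]).realize v = Structure.funMap f ![] :=
    congrArg (Structure.funMap f) (Subsingleton.elim _ _)
  have realize_unary (f : L.Functions 1) (t) (v : Empty ⊕ Fin 3 → M) :
      (Term.func f ![t]).realize v = Structure.funMap f ![t.realize v] :=
    Term.realize_functions_apply₁
  have realize_binary (f : L.Functions 2) (s t) (v : Empty ⊕ Fin 3 → M) :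
      (Term.func f ![s, t]).realize v = Structure.funMap f ![s.realize v, t.realize v] :=
    Term.realize_functions_apply₂
  have forall_unused {p : M → Prop} : (∀ x, M → p x) ↔ ∀ x, p x :=
    ⟨fun h x => h x x, fun h x _ => h x⟩
  have snoc_apply (x y z : M) :
      let v : Fin 3 → M := Fin.snoc (Fin.snoc (Fin.snoc (default : Fin 0 → M) x) y) z
      v 0 = x ∧ v 1 = y ∧ v 2 = z :=
    ⟨rfl, rfl, rfl⟩
  simp only [axiomsBoolean, Theory.model_iff, Set.mem_insert_iff, Set.mem_singleton_iff,
    forall_eq_or_imp, forall_eq, Sentence.Realize, Formula.Realize, BoundedFormula.realize_all,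
    BoundedFormula.realize_bdEqual, tInf, tSup, tCompl, tZero, tOne, tVar, Term.realize_var,
    realize_nullary, realize_unary, realize_binary, Sum.elim_inr, snoc_apply,
    forall_unused]
  exact ⟨fun ⟨h₁, h₂, h₃, h₄, h₅, h₆, h₇, h₈, h₉, h₁₀⟩ => ⟨h₁, h₂, h₃, h₄, h₅, h₆, h₇, h₈, h₉, h₁₀⟩,
    fun ⟨h₁, h₂, h₃, h₄, h₅, h₆, h₇, h₈, h₉, h₁₀⟩ => ⟨h₁, h₂, h₃, h₄, h₅, h₆, h₇, h₈, h₉, h₁₀⟩⟩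

theorem BooleanLaws.isBooleanStructure
    (h : BooleanLaws (M := M) (fun x y => Structure.funMap (L := L) Func.inf ![x, y])
        (fun x y => Structure.funMap (L := L) Func.sup ![x, y])
        (fun x => Structure.funMap (L := L) Func.compl ![x])
        (Structure.funMap (L := L) Func.zero ![]) (Structure.funMap (L := L) Func.one ![])) :
    letI := h.toBooleanAlgebra
    IsBooleanStructure M := by
  let _ := h.toBooleanAlgebra
  refine ⟨fun {n} f v => ?_⟩
  cases f with
  | zero => exact congrArg _ (Subsingleton.elim _ _)
  | one => exact congrArg _ (Subsingleton.elim _ _)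
  | compl => exact congrArg _ (List.ofFn_injective rfl)
  | inf => exact congrArg _ (List.ofFn_injective rfl)
  | sup => exact congrArg _ (List.ofFn_injective rfl)

end BooleanModels

theorem realize_exsLast {M : Type*} [L.Structure M] {m : ℕ} (n : ℕ)
    (φ : L.BoundedFormula Empty (m + n)) (v : Empty → M) (xs : Fin m → M) :
    (exsLast n φ).Realize v xs ↔ ∃ ys : Fin n → M, φ.Realize v (Fin.append xs ys) := by
  induction n with
  | zero =>
    have append_eq (ys : Fin 0 → M) : Fin.append xs ys = xs := by
      rw [Subsingleton.elim ys Fin.elim0, Fin.append_elim0]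
      rfl
    simp only [exsLast, append_eq, exists_const]
  | succ n ih =>
    simp only [exsLast, ih, BoundedFormula.realize_ex, ← Fin.append_snoc]
    exact ⟨fun ⟨ys, a, h⟩ => ⟨_, h⟩,
      fun ⟨ys, h⟩ => ⟨Fin.init ys, ys (Fin.last n), (Fin.snoc_init_self ys).symm ▸ h⟩⟩

theorem le_encard_iff_exists_injective {M : Type*} {n : ℕ} {s : Set M} :
    (n : ℕ∞) ≤ s.encard ↔ ∃ ys : Fin n → M, (∀ i, ys i ∈ s) ∧ Function.Injective ys := by
  constructor
  · intro h
    obtain ⟨t, hts, ht⟩ := Set.exists_subset_encard_eq h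
    have := (Set.finite_of_encard_eq_coe ht).to_subtype
    let e : Fin n ≃ t := (Finite.equivFinOfCardEq (by simp [Set.ncard, ht])).symm
    exact ⟨fun i => e i, fun i => hts (e i).2, Subtype.val_injective.comp e.injective⟩
  · rintro ⟨ys, hys, hinj⟩
    calc (n : ℕ∞) = (Set.range ys).encard := by
          rw [← Set.image_univ, hinj.encard_image, Set.encard_univ]
          simp
      _ ≤ s.encard := Set.encard_le_encard (Set.range_subset_iff.2 hys)

section BooleanStructure

variable {M : Type*} [BooleanAlgebra M] [L.Structure M] [IsBooleanStructure M]

open IsBooleanStructure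

@[simp]
theorem realize_tZero {α : Type} (v : α → M) : (tZero : L.Term α).realize v = ⊥ :=
  funMap_eq _ _

@[simp]
theorem realize_tOne {α : Type} (v : α → M) : (tOne : L.Term α).realize v = ⊤ :=
  funMap_eq _ _

@[simp]
theorem realize_tCompl {α : Type} (t : L.Term α) (v : α → M) :
    (tCompl t).realize v = (t.realize v)ᶜ :=
  funMap_eq _ _

@[simp]
theorem realize_tInf {α : Type} (s t : L.Term α) (v : α → M) :
    (tInf s t).realize v = s.realize v ⊓ t.realize v :=
  funMap_eq _ _

@[simp]
theorem realize_tSup {α : Type} (s t : L.Term α) (v : α → M) :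
    (tSup s t).realize v = s.realize v ⊔ t.realize v :=
  funMap_eq _ _

theorem model_axiomsBoolean : M ⊨ axiomsBoolean := by
  rw [model_axiomsBoolean_iff]
  simp only [funMap_eq]
  exact booleanLaws_of_booleanAlgebra M

@[simp]
theorem realize_fLe {m : ℕ} (s t : L.Term (Empty ⊕ Fin m)) (v : Empty → M) (xs : Fin m → M) :
    (fLe s t).Realize v xs ↔ s.realize (Sum.elim v xs) ≤ t.realize (Sum.elim v xs) := by
  rw [fLe, BoundedFormula.realize_bdEqual, realize_tInf, inf_eq_left]

@[simp]
theorem realize_fAtom {m : ℕ} (i : Fin m) (v : Empty → M) (xs : Fin m → M) :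
    (fAtom i).Realize v xs ↔ IsAtom (xs i) := by
  simp only [fAtom, BoundedFormula.realize_inf, BoundedFormula.realize_not,
    BoundedFormula.realize_bdEqual, BoundedFormula.realize_all, BoundedFormula.realize_imp,
    BoundedFormula.realize_sup, realize_fLe, realize_tZero, tVar, Term.realize_var,
    Sum.elim_inr, Fin.snoc_last, Fin.snoc_castSucc]
  exact ⟨fun ⟨h0, h⟩ => ⟨h0, fun b hb => (h b hb.le).resolve_right hb.ne⟩,
    fun h => ⟨h.1, fun b hb => h.le_iff.1 hb⟩⟩

theorem realize_axiomAtomic : axiomAtomic.Realize M ↔ IsAtomic M := by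
  have snoc_apply (x y : M) :
      let v : Fin 2 → M := Fin.snoc (Fin.snoc (default : Fin 0 → M) x) y
      v 0 = x ∧ v 1 = y :=
    ⟨rfl, rfl⟩
  have snoc_zero (x : M) : (Fin.snoc (default : Fin 0 → M) x : Fin 1 → M) 0 = x := rfl
  simp only [axiomAtomic, Sentence.Realize, Formula.Realize, BoundedFormula.realize_all,
    BoundedFormula.realize_imp, BoundedFormula.realize_not, BoundedFormula.realize_bdEqual,
    BoundedFormula.realize_ex, BoundedFormula.realize_inf, realize_fAtom, realize_fLe,
    realize_tZero, tVar, Term.realize_var, Sum.elim_inr, snoc_apply, snoc_zero]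
  exact ⟨fun h => ⟨fun x => or_iff_not_imp_left.2 (h x)⟩,
    fun h x hx => (h.eq_bot_or_exists_atom_le x).resolve_left hx⟩

theorem realize_axiomC (n : ℕ+) :
    (axiomC n).Realize M ↔ ∀ v : Fin 1 → M,
      Structure.RelMap (L := L) (Rel.C n) v ↔ (structureOf M).RelMap (Rel.C n) v := by
  have forall_snoc {p : (Fin 1 → M) → Prop} :
      (∀ x, p (Fin.snoc (default : Fin 0 → M) x : Fin 1 → M)) ↔ ∀ v, p v :=
    ⟨fun h v => (Fin.snoc_init_self v) ▸ Subsingleton.elim (Fin.init v) default ▸ h _,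
      fun h x => h _⟩
  rw [axiomC, Sentence.Realize, Formula.Realize, BoundedFormula.realize_all, forall_snoc]
  refine forall_congr' fun v => BoundedFormula.realize_iff.trans (iff_congr ?_ ?_)
  · exact iff_of_eq (congrArg (Structure.RelMap _) (List.ofFn_injective rfl))
  · rw [realize_exsLast]
    refine Iff.trans (exists_congr fun ys => ?_) (le_encard_iff_exists_injective (n := n)).symm
    simp only [BoundedFormula.realize_inf, BoundedFormula.realize_iInf, realize_fAtom,
      realize_fLe, BoundedFormula.realize_not, BoundedFormula.realize_bdEqual, tVar,
      Term.realize_var, Sum.elim_inr, Fin.append_right, Fin.append_left, Subtype.forall,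
      Prod.forall]
    exact and_congr Iff.rfl (forall₂_congr fun i j => not_imp_not)

theorem model_axiomsInfAtomic_iff_eq_structureOf : M ⊨ axiomsInfAtomic ↔
    Infinite M ∧ IsAtomic M ∧ ‹L.Structure M› = structureOf M := by
  simp only [axiomsInfAtomic, Theory.model_union_iff, Theory.model_singleton_iff,
    model_infiniteTheory_iff, model_axiomsBoolean, realize_axiomAtomic, true_and, and_assoc]
  refine and_congr_right fun _ => and_congr_right fun _ => ?_
  simp only [Theory.model_iff, Set.forall_mem_range, realize_axiomC]
  refine ⟨fun h => ?_, fun h n v => by rw [h]⟩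
  ext n f v
  · exact funMap_eq f v
  · cases f
    exact h _ v

end BooleanStructure

theorem model_axiomsInfAtomic_iff {M : Type*} (S : L.Structure M) :
    M ⊨ axiomsInfAtomic ↔
      Infinite M ∧ ∃ _ : BooleanAlgebra M, IsAtomic M ∧ S = structureOf M := by
  constructor
  · intro h
    have laws := model_axiomsBoolean_iff.1
      (h.mono (Set.subset_union_left.trans
        (Set.subset_union_left.trans Set.subset_union_left)))
    let _ := laws.toBooleanAlgebra
    have := laws.isBooleanStructure
    obtain ⟨hinf, hM⟩ := model_axiomsInfAtomic_iff_eq_structureOf.1 h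
    exact ⟨hinf, _, hM⟩
  · rintro ⟨hinf, _, hatomic, rfl⟩
    let _ := structureOf M
    exact model_axiomsInfAtomic_iff_eq_structureOf.2 ⟨hinf, hatomic, rfl⟩

theorem term_induction {α : Type} {motive : L.Term α → Prop} (var : ∀ i, motive (Term.var i))
    (zero : motive tZero) (one : motive tOne) (compl : ∀ t, motive t → motive (tCompl t))
    (inf : ∀ s t, motive s → motive t → motive (tInf s t))
    (sup : ∀ s t, motive s → motive t → motive (tSup s t)) (t : L.Term α) : motive t := by
  induction t with
  | var i => exact var i
  | func f ts ih =>
    cases f with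
    | zero => exact (Subsingleton.elim ![] ts) ▸ zero
    | one => exact (Subsingleton.elim ![] ts) ▸ one
    | compl => exact (List.ofFn_injective rfl : ![ts 0] = ts) ▸ compl _ (ih 0)
    | inf => exact (List.ofFn_injective rfl : ![ts 0, ts 1] = ts) ▸ inf _ _ (ih 0) (ih 1)
    | sup => exact (List.ofFn_injective rfl : ![ts 0, ts 1] = ts) ▸ sup _ _ (ih 0) (ih 1)

/-! ### Cells of atoms -/

attribute [local instance] structureOf

section Cells

variable {B B' : Type*} [BooleanAlgebra B] [BooleanAlgebra B'] {ι : Type*}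

theorem le_realize_iff_of_isAtom {α : Type} {a : B} (ha : IsAtom a) {v : α → B} (t : L.Term α) :
    a ≤ t.realize v ↔ t.realize fun i => a ≤ v i := by
  induction t using term_induction with
  | var i => simp only [Term.realize_var]
  | zero => simpa using ha.1
  | one => simp
  | compl t ih => simp [le_compl_iff_of_isAtom ha, ih]
  | inf s t ihs iht => simp [ihs, iht]
  | sup s t ihs iht => simp [le_sup_iff_of_isAtom ha, ihs, iht]

theorem atomsBelow_realize {α : Type} (t : L.Term α) (v : α → B) :
    atomsBelow (t.realize v) = {a | IsAtom a ∧ t.realize fun i => a ≤ v i} :=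
  Set.ext fun _ => and_congr_right fun ha => le_realize_iff_of_isAtom ha t

open scoped Classical in
/-- The intersection of the variables that satisfy `S` and of the complements of the others: its
value on a family is an element with the atoms `cell v S` below it. -/
noncomputable def cellTerm {α : Type} [Finite α] (S : α → Prop) : L.Term α :=
  let _ := Fintype.ofFinite α
  (Finset.univ.toList.map fun i => if S i then .var i else tCompl (.var i)).foldr tInf tOne

theorem realize_cellTerm {α : Type} [Finite α] (S P : α → Prop) :
    (cellTerm S).realize P ↔ P = S := by
  classical
  let _ := Fintype.ofFinite α
  have realize_foldr (l : List (L.Term α)) :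
      (l.foldr tInf tOne).realize P ↔ ∀ t ∈ l, t.realize P := by
    induction l with
    | nil => simp
    | cons t l ih => simp [ih]
  simp only [cellTerm, realize_foldr, List.forall_mem_map, Finset.mem_toList, Finset.mem_univ,
    true_imp_iff, funext_iff]
  refine forall_congr' fun i => ?_
  by_cases h : S i <;> simp [h]

/-- The atoms that lie below exactly those `v i` for which `S i` holds. -/
def cell (v : ι → B) (S : ι → Prop) : Set B := {a | IsAtom a ∧ (fun i => a ≤ v i) = S}

theorem cell_eq_atomsBelow {α : Type} [Finite α] (v : α → B) (S : α → Prop) :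
    cell v S = atomsBelow ((cellTerm S).realize v) := by
  simp only [atomsBelow_realize, realize_cellTerm, cell]

theorem pairwise_disjoint_cell (v : ι → B) : Pairwise (Function.onFun Disjoint (cell v)) :=
  fun _ _ hne => Set.disjoint_left.2 fun _ h h' => hne (h.2.symm.trans h'.2)

theorem encard_setOf_isAtom_and [Finite ι] (v : ι → B) (p : (ι → Prop) → Prop)
    [Fintype {S // p S}] :
    {a | IsAtom a ∧ p fun i => a ≤ v i}.encard = ∑ S : {S // p S}, (cell v S.1).encard := by
  rw [← finsum_eq_sum_of_fintype, ← Set.encard_iUnion_of_finite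
    ((pairwise_disjoint_cell v).comp_of_injective Subtype.val_injective)]
  congr 1
  ext a
  simp [cell]

/-- Two families are similar up to `K` if corresponding cells have the same number of atoms, where
all numbers that are at least `K` are identified. -/
def Similar (K : ℕ) (v : ι → B) (v' : ι → B') : Prop :=
  ∀ S : ι → Prop, EqUpTo K (cell v S).encard (cell v' S).encard

variable {K M : ℕ} {v : ι → B} {v' : ι → B'}

theorem Similar.symm (h : Similar K v v') : Similar K v' v := fun S => (h S).symm

theorem Similar.mono (hKM : K ≤ M) (h : Similar M v v') : Similar K v v' :=
  fun S => (h S).mono hKM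

theorem Similar.encard [Finite ι] (h : Similar K v v') (p : (ι → Prop) → Prop) :
    EqUpTo K {a | IsAtom a ∧ p fun i => a ≤ v i}.encard
      {a | IsAtom a ∧ p fun i => a ≤ v' i}.encard := by
  classical
  let _ := Fintype.ofFinite (ι → Prop)
  rw [encard_setOf_isAtom_and, encard_setOf_isAtom_and]
  exact .sum fun S _ => h S

theorem exists_forall_cell_inter_eq {α : Type} [Finite α] {v : α → B} {A : (α → Prop) → Set B}
    (hsub : ∀ S, A S ⊆ cell v S) (hA : ∀ S, (A S).Finite ∨ (cell v S \ A S).Finite) :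
    ∃ x, ∀ S, cell v S ∩ {a | a ≤ x} = A S := by
  classical
  let _ := Fintype.ofFinite (α → Prop)
  have exists_y (S) : ∃ y, atomsBelow y = A S :=
    exists_atomsBelow_eq (cell_eq_atomsBelow v S ▸ hsub S) (cell_eq_atomsBelow v S ▸ hA S)
  choose y hy using exists_y
  refine ⟨Finset.univ.sup y, fun S => Set.ext fun a => ⟨?_, fun ha => ?_⟩⟩
  · rintro ⟨⟨ha, rfl⟩, hle⟩
    obtain ⟨S, -, hS⟩ := (le_finset_sup_iff_of_isAtom ha _ _).1 hle
    have haS : a ∈ A S := hy S ▸ ⟨ha, hS⟩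
    rwa [(hsub S haS).2]
  · have haS : a ∈ cell v S := hsub S ha
    rw [← hy S] at ha
    exact ⟨haS, ha.2.trans (Finset.le_sup (Finset.mem_univ S))⟩

theorem Similar.exists_extension {α : Type} [Finite α] {v : α → B} {v' : α → B'}
    (h : Similar (2 * K) v v') (x : B) :
    ∃ x' : B', ∀ S : α → Prop,
      EqUpTo K (cell v S ∩ {a | a ≤ x}).encard (cell v' S ∩ {a | a ≤ x'}).encard ∧
        EqUpTo K (cell v S \ {a | a ≤ x}).encard (cell v' S \ {a | a ≤ x'}).encard := by
  choose A hsub hA hin hout using fun S => (h S).exists_subset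
    (Set.inter_subset_left : cell v S ∩ {a | a ≤ x} ⊆ cell v S)
  obtain ⟨x', hx'⟩ := exists_forall_cell_inter_eq hsub hA
  refine ⟨x', fun S => ⟨hx' S ▸ hin S, ?_⟩⟩
  have := hout S
  rwa [← hx', Set.sdiff_self_inter, Set.sdiff_self_inter] at this

open scoped Classical in
theorem cell_snoc {α : Type*} {m : ℕ} (v : α → B) (xs : Fin m → B) (x : B)
    (S : α ⊕ Fin (m + 1) → Prop) :
    cell (Sum.elim v (Fin.snoc xs x : Fin (m + 1) → B)) S =
      if S (.inr (Fin.last m)) then cell (Sum.elim v xs) (S ∘ Sum.map id Fin.castSucc) ∩ {a | a ≤ x}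
      else cell (Sum.elim v xs) (S ∘ Sum.map id Fin.castSucc) \ {a | a ≤ x} := by
  ext a
  split_ifs with h <;>
  · simp only [cell, funext_iff, Sum.forall, Fin.forall_fin_succ', Sum.elim_inl, Sum.elim_inr,
      Fin.snoc_castSucc, Fin.snoc_last, Set.mem_ofPred_eq, Set.mem_inter_iff, Set.mem_sdiff,
      Function.comp_apply, Sum.map_inl, Sum.map_inr, h, id_eq, eq_iff_iff, iff_true, iff_false]
    tauto

theorem Similar.exists_snoc {α : Type} [Finite α] {m : ℕ} {v : α → B} {xs : Fin m → B}
    {v' : α → B'} {xs' : Fin m → B'} (h : Similar (2 * K) (Sum.elim v xs) (Sum.elim v' xs'))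
    (x : B) :
    ∃ x' : B', Similar K (Sum.elim v (Fin.snoc xs x : Fin (m + 1) → B))
      (Sum.elim v' (Fin.snoc xs' x' : Fin (m + 1) → B')) := by
  obtain ⟨x', hx'⟩ := h.exists_extension x
  refine ⟨x', fun S => ?_⟩
  rw [cell_snoc, cell_snoc]
  split_ifs
  · exact (hx' _).1
  · exact (hx' _).2

theorem similar_of_isEmpty [IsEmpty ι] (hB : (K : ℕ∞) ≤ {a : B | IsAtom a}.encard)
    (hB' : (K : ℕ∞) ≤ {a : B' | IsAtom a}.encard) (v : ι → B) (v' : ι → B') : Similar K v v' :=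
  fun S => .inr (by simpa [cell, Subsingleton.elim _ S] using ⟨hB, hB'⟩)

end Cells

section Formulas

variable {B B' : Type*} [BooleanAlgebra B] [BooleanAlgebra B'] [IsAtomic B] [IsAtomic B']
  {α : Type}

/-- How precisely the cells have to be counted in order to determine the truth of a formula. -/
def weight : {m : ℕ} → L.BoundedFormula α m → ℕ
  | _, .falsum => 0
  | _, .equal _ _ => 1
  | _, .rel (Rel.C n) _ => n
  | _, .imp φ ψ => max (weight φ) (weight ψ)
  | _, .all φ => 2 * weight φ

theorem realize_eq_iff_not_one_le_encard (s t : L.Term α) (v : α → B) :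
    s.realize v = t.realize v ↔
      ¬ ((1 : ℕ) : ℕ∞) ≤ {a | IsAtom a ∧
        ¬ ((s.realize fun i => a ≤ v i) ↔ t.realize fun i => a ≤ v i)}.encard := by
  rw [BooleanAlgebra.eq_iff_atom_le_iff, Nat.cast_one, Set.one_le_encard_iff_nonempty,
    Set.not_nonempty_iff_eq_empty, Set.eq_empty_iff_forall_notMem]
  refine forall_congr' fun a => ?_
  rw [Set.mem_ofPred_eq, not_and_not_right]
  refine imp_congr_right fun ha => ?_
  rw [le_realize_iff_of_isAtom ha, le_realize_iff_of_isAtom ha]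

theorem realize_iff_of_similar [Finite α] {m : ℕ} (φ : L.BoundedFormula α m) {v : α → B}
    {v' : α → B'} {xs : Fin m → B} {xs' : Fin m → B'}
    (h : Similar (weight φ) (Sum.elim v xs) (Sum.elim v' xs')) :
    φ.Realize v xs ↔ φ.Realize v' xs' := by
  induction φ with
  | falsum => rfl
  | equal s t =>
    exact (realize_eq_iff_not_one_le_encard s t _).trans
      ((not_congr ((h.encard fun P => ¬ (s.realize P ↔ t.realize P)).le_iff le_rfl)).trans
        (realize_eq_iff_not_one_le_encard s t _).symm)
  | rel R ts =>
    obtain ⟨n⟩ := R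
    have := (h.encard (ts 0).realize).le_iff le_rfl
    rwa [← atomsBelow_realize, ← atomsBelow_realize] at this
  | imp φ ψ hφ hψ =>
    exact imp_congr (hφ (h.mono (le_max_left _ _))) (hψ (h.mono (le_max_right _ _)))
  | all φ ih =>
    constructor
    · intro H x'
      obtain ⟨x, hx⟩ := h.symm.exists_snoc x'
      exact (ih hx.symm).1 (H x)
    · intro H x
      obtain ⟨x', hx⟩ := h.exists_snoc x
      exact (ih hx).2 (H x')

theorem realize_sentence_iff_of_le_encard (φ : L.Sentence)
    (hB : (weight φ : ℕ∞) ≤ {a : B | IsAtom a}.encard)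
    (hB' : (weight φ : ℕ∞) ≤ {a : B' | IsAtom a}.encard) :
    φ.Realize B ↔ φ.Realize B' :=
  realize_iff_of_similar φ (similar_of_isEmpty hB hB' _ _)

end Formulas

/-! ### Completeness and quantifier elimination -/

section Completeness

theorem realize_sentence_iff {B B' : Type*} [BooleanAlgebra B] [BooleanAlgebra B'] [IsAtomic B]
    [IsAtomic B'] [Infinite B] [Infinite B'] (φ : L.Sentence) : φ.Realize B ↔ φ.Realize B' :=
  realize_sentence_iff_of_le_encard φ (by simp [encard_isAtom_eq_top])
    (by simp [encard_isAtom_eq_top])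

theorem axiomsInfAtomic_subset : axiomsInfAtomic ⊆ theoryInfAtomic.{u} := fun φ hφ B _ _ _ =>
  ((model_axiomsInfAtomic_iff (structureOf B)).2
    ⟨‹_›, ‹_›, ‹_›, rfl⟩).realize_of_mem φ hφ

theorem model_theoryInfAtomic : Set ℕ ⊨ theoryInfAtomic.{u} :=
  ⟨fun φ hφ => (realize_sentence_iff φ).1 (hφ (Set (ULift.{u} ℕ)))⟩

theorem models_iff_realize {T : L.Theory} (hT : axiomsInfAtomic ⊆ T) (hN : Set ℕ ⊨ T)
    (φ : L.Sentence) : T ⊨ᵇ φ ↔ φ.Realize (Set ℕ) := by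
  rw [Theory.models_sentence_iff]
  refine ⟨fun h => h (Theory.ModelType.of T (Set ℕ)), ?_⟩
  rintro h @⟨M, S, hM, _⟩
  obtain ⟨_, _, _, rfl⟩ := (model_axiomsInfAtomic_iff S).1 (hM.mono hT)
  exact (realize_sentence_iff φ).1 h

theorem theoryInfAtomic_models_iff (φ : L.Sentence) :
    theoryInfAtomic.{u} ⊨ᵇ φ ↔ φ.Realize (Set ℕ) :=
  models_iff_realize axiomsInfAtomic_subset model_theoryInfAtomic φ

theorem isComplete_theoryInfAtomic : theoryInfAtomic.{u}.IsComplete := by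
  have := model_theoryInfAtomic.{u}
  refine ⟨⟨Theory.ModelType.of _ (Set ℕ)⟩, fun φ => ?_⟩
  rw [theoryInfAtomic_models_iff, theoryInfAtomic_models_iff, Sentence.realize_not]
  exact em _

theorem isAxiomatizedBy_axiomsInfAtomic :
    IsAxiomatizedBy theoryInfAtomic.{u} axiomsInfAtomic := fun φ => by
  rw [theoryInfAtomic_models_iff,
    models_iff_realize subset_rfl (model_theoryInfAtomic.{u}.mono axiomsInfAtomic_subset)]

end Completeness

section QuantifierElimination

section General

universe u₁ v₁ w

variable {L' : FirstOrder.Language.{u₁, v₁}} {α : Type w} {κ : Type*} [Finite κ] {n : ℕ}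
  {θ : κ → L'.BoundedFormula α n}

theorem isQF_iSup (hθ : ∀ k, (θ k).IsQF) : (BoundedFormula.iSup θ).IsQF := by
  rw [BoundedFormula.iSup]
  induction Finset.toList _ with
  | nil => exact BoundedFormula.isQF_bot
  | cons k l ih => exact (hθ k).sup ih

theorem isQF_iInf (hθ : ∀ k, (θ k).IsQF) : (BoundedFormula.iInf θ).IsQF := by
  rw [BoundedFormula.iInf]
  induction Finset.toList _ with
  | nil => exact BoundedFormula.IsQF.top
  | cons k l ih => exact (hθ k).inf ih

-- The quantifier-free formula is the disjunction of the patterns of truth values of the `θ k` that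
-- occur together with `φ` in a model of `T`.
theorem exists_isQF_iff_of_forall_realize_iff {T : L'.Theory} {φ : L'.BoundedFormula α n}
    (hθ : ∀ k, (θ k).IsQF)
    (hφ : ∀ (M N : Theory.ModelType.{u₁, v₁, max u₁ v₁ w} T) (v : α → M) (xs : Fin n → M)
      (w : α → N) (ys : Fin n → N),
      (∀ k, (θ k).Realize v xs ↔ (θ k).Realize w ys) → φ.Realize v xs → φ.Realize w ys) :
    ∃ ψ : L'.BoundedFormula α n, ψ.IsQF ∧ φ ⇔[T] ψ := by
  classical
  let Pattern := {p : κ → Prop // ∃ (M : Theory.ModelType.{u₁, v₁, max u₁ v₁ w} T) (v : α → M)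
    (xs : Fin n → M), φ.Realize v xs ∧ ∀ k, (θ k).Realize v xs ↔ p k}
  let literal (p : κ → Prop) (k : κ) : L'.BoundedFormula α n := if p k then θ k else ∼(θ k)
  have isQF_literal (p k) : (literal p k).IsQF := by
    unfold literal
    split_ifs
    exacts [hθ k, (hθ k).not]
  have realize_literal {M : Type _} [L'.Structure M] {v : α → M} {xs : Fin n → M} {p k} :
      (literal p k).Realize v xs ↔ ((θ k).Realize v xs ↔ p k) := by
    by_cases h : p k <;> simp [literal, h]
  refine ⟨.iSup fun p : Pattern => .iInf (literal p.1),
    isQF_iSup fun p => isQF_iInf (isQF_literal p.1), fun N w ys => ?_⟩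
  simp only [BoundedFormula.realize_iff, BoundedFormula.realize_iSup, BoundedFormula.realize_iInf]
  constructor
  · exact fun h => ⟨⟨_, N, w, ys, h, fun _ => Iff.rfl⟩, fun _ => realize_literal.2 Iff.rfl⟩
  · rintro ⟨⟨p, M, v, xs, h, hp⟩, hp'⟩
    exact hφ M N v xs w ys (fun k => (hp k).trans (realize_literal.1 (hp' k)).symm) h

end General

variable {α : Type} [Finite α] {n : ℕ}

/-- The formula saying that the cell of type `S` has more than `k` atoms. -/
noncomputable def cellFormula (S : α ⊕ Fin n → Prop) (k : ℕ) : L.BoundedFormula α n :=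
  .rel (Rel.C k.succPNat) ![cellTerm S]

theorem realize_cellFormula {B : Type*} [BooleanAlgebra B] (S : α ⊕ Fin n → Prop) (k : ℕ)
    (v : α → B) (xs : Fin n → B) :
    (cellFormula S k).Realize v xs ↔
      ((k + 1 : ℕ) : ℕ∞) ≤ (cell (Sum.elim v xs) S).encard := by
  rw [cell_eq_atomsBelow]
  rfl

theorem exists_isQF_iff_theoryInfAtomic (φ : L.BoundedFormula α n) :
    ∃ ψ : L.BoundedFormula α n, ψ.IsQF ∧ φ ⇔[theoryInfAtomic.{u}] ψ := by
  refine exists_isQF_iff_of_forall_realize_iff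
    (θ := fun k : (α ⊕ Fin n → Prop) × Fin (weight φ) => cellFormula k.1 k.2)
    (fun _ => (BoundedFormula.IsAtomic.rel _ _).isQF) ?_
  rintro @⟨M, S, hM, _⟩ @⟨N, S', hN, _⟩ v xs w ys h
  obtain ⟨_, _, _, rfl⟩ := (model_axiomsInfAtomic_iff S).1 (hM.mono axiomsInfAtomic_subset)
  obtain ⟨_, _, _, rfl⟩ := (model_axiomsInfAtomic_iff S').1 (hN.mono axiomsInfAtomic_subset)
  refine (realize_iff_of_similar φ fun S => .of_forall_lt fun k hk => ?_).1
  rw [← realize_cellFormula, ← realize_cellFormula]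
  exact h (S, ⟨k, hk⟩)

theorem hasQuantifierElimination_theoryInfAtomic :
    HasQuantifierElimination theoryInfAtomic.{u} :=
  fun _ φ => exists_isQF_iff_theoryInfAtomic φ

end QuantifierElimination

/-! ### Decidability -/

section RecursiveCalls

open Encodable Nat.Partrec

theorem list_mapM_eq_some {α : Type*} {σ : Type*} {g : α → Part σ} {f : α → σ} {l : List α}
    (h : ∀ a ∈ l, g a = Part.some (f a)) : l.mapM g = Part.some (l.map f) := by
  induction l with
  | nil => rfl
  | cons a l ih =>
    rw [List.forall_mem_cons] at h
    simp [h.1, ih h.2]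

variable {α β σ : Type*} [Primcodable α] [Primcodable β] [Primcodable σ]

theorem partrec_list_mapM {g : β → α → Part σ} (hg : Partrec₂ g) :
    Partrec₂ fun (b : β) (l : List α) => l.mapM (g b) := by
  have hbody : Partrec₂ fun (x : β × List α) (y : ℕ × List σ) =>
      (Part.ofOption x.2[y.1]?).bind fun a => (g x.1 a).map fun z => y.2 ++ [z] := by
    refine Partrec.bind (Computable.ofOption (Computable.list_getElem?.comp
      (Computable.snd.comp Computable.fst) (Computable.fst.comp Computable.snd))) ?_
    refine Partrec.map (hg.comp (Computable.fst.comp (Computable.fst.comp Computable.fst))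
      Computable.snd) ?_
    exact Computable.list_concat.comp
      (Computable.snd.comp (Computable.snd.comp (Computable.fst.comp Computable.fst)))
      Computable.snd
  refine (Partrec.nat_rec (Computable.list_length.comp Computable.snd)
    (Computable.const ([] : List σ)).partrec hbody).of_eq fun ⟨b, l⟩ => ?_
  have htake (k : ℕ) (hk : k ≤ l.length) :
      Nat.rec (motive := fun _ => Part (List σ)) (Part.some [])
        (fun i acc => acc.bind fun ys =>
          (Part.ofOption l[i]?).bind fun a => (g b a).map fun z => ys ++ [z]) k =
        (l.take k).mapM (g b) := by
    induction k with
    | zero => rfl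
    | succ k ih =>
      rw [← List.take_append_getElem hk, List.mapM_append]
      simp [← ih (by omega), List.getElem?_eq_getElem hk, Part.bind_some_eq_map, Part.map_map,
        Function.comp_def]
  simpa using htake l.length le_rfl

theorem computable_of_recursive_calls {f : α → σ} {calls : α → List α} {step : α → List σ → σ}
    {r : α → α → Prop} (hr : WellFounded r) (hrcalls : ∀ x, ∀ y ∈ calls x, r y x)
    (hcalls : Computable calls) (hstep : Computable₂ step)
    (hf : ∀ x, f x = step x ((calls x).map f)) : Computable f := by
  let run (e : Code) (x : α) : Part σ :=
    (e.eval (encode x)).bind fun n => Part.ofOption (decode n)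
  have hrun : Partrec₂ run :=
    Partrec.bind (Code.eval_part.comp Computable.fst (Computable.encode.comp Computable.snd))
      (Computable.ofOption (Computable.decode.comp Computable.snd))
  let body (e : Code) (x : α) : Part σ := ((calls x).mapM (run e)).map (step x)
  have hbody : Partrec₂ body :=
    Partrec.map ((partrec_list_mapM hrun).comp Computable.fst (hcalls.comp Computable.snd))
      (hstep.comp (Computable.snd.comp Computable.fst) Computable.snd)
  have hcode : Partrec₂ fun (e : Code) (n : ℕ) =>
      (Part.ofOption (decode (α := α) n)).bind fun x => (body e x).map encode := by
    refine Partrec.bind (Computable.ofOption (Computable.decode.comp Computable.snd)) ?_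
    exact Partrec.map (hbody.comp (Computable.fst.comp Computable.fst) Computable.snd)
      (Computable.encode.comp Computable.snd)
  obtain ⟨e, he⟩ := Code.fixed_point₂ hcode
  have hfix (x : α) : run e x = body e x := by
    simp [run, he, Part.bind_map]
  have hval (x : α) : run e x = Part.some (f x) := by
    induction x using hr.induction with
    | _ x ih =>
      rw [hfix, hf]
      simp only [body, list_mapM_eq_some fun y hy => ih y (hrcalls x y hy), Part.map_some]
  exact Partrec.of_eq_tot (hrun.comp (Computable.const e) Computable.id) fun x => by
    simp [hval]

end RecursiveCalls

section Codes

variable {A σ : Type*} {c : A → ℕ} {f : A → σ} {m n : ℕ} {x : σ}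

/-- The value of `f` at the object with code `n`, and `none` if `n` is not a code. -/
noncomputable def valOfCode (c : A → ℕ) (f : A → σ) (n : ℕ) : Option σ :=
  (Function.partialInv c n).map f

theorem valOfCode_eq_some_iff (hc : Function.Injective c) :
    valOfCode c f n = some x ↔ ∃ a, c a = n ∧ f a = x := by
  simp only [valOfCode, Option.map_eq_some_iff, hc.isPartialInv _ _]

theorem map_valOfCode_eq_some_iff (hc : Function.Injective c) (g : σ → σ) :
    (valOfCode c f n).map g = some x ↔ ∃ a, c a = n ∧ g (f a) = x := by
  simp [valOfCode, hc.isPartialInv _ _]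

theorem map₂_valOfCode_eq_some_iff (hc : Function.Injective c) (g : σ → σ → σ) :
    Option.map₂ g (valOfCode c f m) (valOfCode c f n) = some x ↔
      ∃ a b, (c a = m ∧ c b = n) ∧ g (f a) (f b) = x := by
  simp only [Option.map₂_eq_some_iff, Option.mem_def, valOfCode_eq_some_iff hc]
  constructor
  · rintro ⟨_, _, ⟨a, ha, rfl⟩, ⟨b, hb, rfl⟩, h⟩
    exact ⟨a, b, ⟨ha, hb⟩, h⟩
  · rintro ⟨a, b, ⟨ha, hb⟩, h⟩
    exact ⟨_, _, ⟨a, ha, rfl⟩, ⟨b, hb, rfl⟩, h⟩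

theorem valOfCode_apply (hc : Function.Injective c) (a : A) : valOfCode c f (c a) = some (f a) :=
  (valOfCode_eq_some_iff hc).2 ⟨a, rfl, rfl⟩

theorem lt_pair_right {a b : ℕ} (ha : 0 < a) : b < Nat.pair a b := by
  have := Nat.add_le_pair a b
  omega

theorem lt_pair_pair_left {a b c : ℕ} (ha : 0 < a) : b < Nat.pair a (Nat.pair b c) :=
  (Nat.left_le_pair b c).trans_lt (lt_pair_right ha)

theorem lt_pair_pair_right {a b c : ℕ} (ha : 0 < a) : c < Nat.pair a (Nat.pair b c) :=
  (Nat.right_le_pair b c).trans_lt (lt_pair_right ha)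

end Codes

section Evaluation

theorem exists_term_iff {α : Type} {P : L.Term α → Prop} :
    (∃ t, P t) ↔ (∃ i, P (.var i)) ∨ P tZero ∨ P tOne ∨ (∃ t, P (tCompl t)) ∨
      (∃ s t, P (tInf s t)) ∨ ∃ s t, P (tSup s t) := by
  constructor
  · rintro ⟨t, ht⟩
    induction t using term_induction <;> grind
  · grind

theorem exists_formula_iff {m : ℕ} {P : L.BoundedFormula Empty m → Prop} :
    (∃ φ, P φ) ↔ P .falsum ∨ (∃ s t, P (.equal s t)) ∨ (∃ n t, P (.rel (Rel.C n) ![t])) ∨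
      (∃ φ ψ, P (.imp φ ψ)) ∨ ∃ φ, P (.all φ) := by
  constructor
  · rintro ⟨_ | _ | ⟨⟨n⟩, ts⟩ | _ | _, h⟩
    case rel =>
      rw [← FinVec.etaExpand_eq ts] at h
      exact .inr (.inr (.inl ⟨n, ts 0, h⟩))
    all_goals grind
  · grind

theorem termCode_tVar {m : ℕ} (i : Fin m) : termCode (tVar i) = Nat.pair 0 i := rfl

theorem termCode_tZero {m : ℕ} : termCode (tZero : L.Term (Empty ⊕ Fin m)) = Nat.pair 1 0 := rfl

theorem termCode_tOne {m : ℕ} : termCode (tOne : L.Term (Empty ⊕ Fin m)) = Nat.pair 2 0 := rfl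

variable {m : ℕ} (s t : L.Term (Empty ⊕ Fin m))

theorem termCode_tCompl : termCode (tCompl t) = Nat.pair 3 (termCode t) := rfl

theorem termCode_tInf :
    termCode (tInf s t) = Nat.pair 4 (Nat.pair (termCode s) (termCode t)) := rfl

theorem termCode_tSup :
    termCode (tSup s t) = Nat.pair 5 (Nat.pair (termCode s) (termCode t)) := rfl

section TermTruth

open Classical in
/-- The truth value of a term at a point `i`, where the variables stand for sets of points that are
given as binary numbers. The last variable is the head of the list `v`, so that a quantifier adds
its variable by consing. -/
noncomputable def termTruth (i : ℕ) (v : List ℕ) (t : L.Term (Empty ⊕ Fin v.length)) : Bool :=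
  decide (t.realize (Sum.elim Empty.elim fun j => ((v.get j.rev).testBit i : Prop)))

variable {i : ℕ} {v : List ℕ} (s t : L.Term (Empty ⊕ Fin v.length))

theorem termTruth_iff :
    termTruth i v t ↔
      t.realize (Sum.elim Empty.elim fun j => ((v.get j.rev).testBit i : Prop)) := by
  classical exact decide_eq_true_iff

theorem termTruth_tVar (j : Fin v.length) :
    termTruth i v (tVar j) = (v.get j.rev).testBit i :=
  Bool.eq_iff_iff.2 (termTruth_iff _)

theorem termTruth_tZero : termTruth i v tZero = false := by
  rw [← Bool.not_eq_true, termTruth_iff, realize_tZero]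
  exact id

theorem termTruth_tOne : termTruth i v tOne = true := by
  rw [termTruth_iff, realize_tOne]
  trivial

theorem termTruth_tCompl : termTruth i v (tCompl t) = !termTruth i v t := by
  rw [Bool.eq_iff_iff, Bool.not_eq_true', ← Bool.not_eq_true, termTruth_iff, termTruth_iff,
    realize_tCompl, compl_iff_not]

theorem termTruth_tInf : termTruth i v (tInf s t) = (termTruth i v s && termTruth i v t) := by
  rw [Bool.eq_iff_iff]
  simp [termTruth_iff]

theorem termTruth_tSup : termTruth i v (tSup s t) = (termTruth i v s || termTruth i v t) := by
  rw [Bool.eq_iff_iff]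
  simp [termTruth_iff]

end TermTruth

/-- The truth value at the point `i` of the term with a given code. -/
noncomputable def termVal (i : ℕ) (v : List ℕ) : ℕ → Option Bool :=
  valOfCode termCode (termTruth i v)

/-- The value of `termVal i v` at the number `l.length`, computed from the list `l` of its values at
all smaller numbers. -/
def termStep (i : ℕ) (v : List ℕ) (l : List (Option Bool)) : Option Bool :=
  let p := l.length.unpair.2
  let rec₀ := l.getD p none
  let rec₁ := l.getD p.unpair.1 none
  let rec₂ := l.getD p.unpair.2 none
  [v.reverse[p]?.map (Nat.testBit · i),
    if p = 0 then some false else none,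
    if p = 0 then some true else none,
    rec₀.map not,
    Option.map₂ and rec₁ rec₂,
    Option.map₂ or rec₁ rec₂].getD l.length.unpair.1 none

theorem termVal_eq_termStep (i : ℕ) (v : List ℕ) (n : ℕ) :
    termVal i v n = termStep i v ((List.range n).map (termVal i v)) := by
  obtain ⟨a, p, rfl⟩ : ∃ a p, n = Nat.pair a p := ⟨_, _, (Nat.pair_unpair n).symm⟩
  obtain ⟨q, r, hp⟩ : ∃ q r, p = Nat.pair q r := ⟨_, _, (Nat.pair_unpair p).symm⟩
  ext b
  rw [termVal, valOfCode_eq_some_iff termCode_injective, exists_term_iff, ← termVal]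
  simp only [Sum.exists, IsEmpty.exists_iff, false_or, termCode_tVar, termCode_tZero,
    termCode_tOne, termCode_tCompl, termCode_tInf, termCode_tSup, termTruth_tVar, termTruth_tZero,
    termTruth_tOne, termTruth_tCompl, termTruth_tInf, termTruth_tSup, Nat.pair_eq_pair, termStep,
    List.length_map, List.length_range, Nat.unpair_pair]
  match a with
  | 0 =>
    simp only [true_and, Fin.exists_iff]
    simp only [one_ne_zero, OfNat.ofNat_ne_zero, false_and, exists_and_left, exists_eq_left,
      exists_false, or_false, List.get_eq_getElem, Fin.val_rev, List.getD_cons_zero,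
      Option.map_eq_some_iff, List.getElem?_eq_some_iff, List.length_reverse]
    grind
  | 1 => by_cases h : p = 0 <;> simp [h, eq_comm (a := 0)]
  | 2 => by_cases h : p = 0 <;> simp [h, eq_comm (a := 0)]
  | 3 =>
    simp [lt_pair_right, termVal, map_valOfCode_eq_some_iff termCode_injective,
      -Option.map_eq_some_iff]
  | 4 =>
    simp [hp, lt_pair_pair_left, lt_pair_pair_right, termVal,
      map₂_valOfCode_eq_some_iff termCode_injective]
  | 5 =>
    simp [hp, lt_pair_pair_left, lt_pair_pair_right, termVal,
      map₂_valOfCode_eq_some_iff termCode_injective]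
  | a + 6 => simp

/-- The set of the positions below `N` of the binary digits `1` of `x`. Numbers stand in this way
for the elements of the algebra of subsets of `Fin N`. -/
def bits (N x : ℕ) : Set (Fin N) := {i | x.testBit i}

theorem forall_bits_iff {N : ℕ} {p : Set (Fin N) → Prop} :
    (∀ s, p s) ↔ ∀ x < 2 ^ N, p (bits N x) := by
  classical
  refine ⟨fun h x _ => h _, fun h s => ?_⟩
  convert h (Nat.ofBits fun i : Fin N => decide (i ∈ s)) (Nat.ofBits_lt_two_pow _)
  ext i
  simp [bits, Nat.testBit_ofBits_lt]

theorem encard_setOf_fin (N : ℕ) (p : ℕ → Bool) :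
    {i : Fin N | p i}.encard = ((List.range N).filter p).length := by
  rw [← Fin.val_injective.encard_image, ← List.toFinset_card_of_nodup (List.nodup_range.filter p),
    ← Set.encard_coe_eq_coe_finsetCard]
  congr 1
  ext x
  simp [Fin.exists_iff, and_comm]

/-- The assignment of subsets of `Fin N` to the variables that is coded by the list `v`. The last
variable is assigned the head of the list. -/
def assignment (N : ℕ) (v : List ℕ) (j : Fin v.length) : Set (Fin N) := bits N (v.get j.rev)

theorem assignment_cons (N x : ℕ) (v : List ℕ) :
    assignment N (x :: v) = Fin.snoc (α := fun _ => Set (Fin N)) (assignment N v) (bits N x) := by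
  funext j
  induction j using Fin.lastCases with
  | last => simp [assignment]
  | cast j => simp [assignment, Fin.rev_castSucc]

theorem mem_realize_assignment_iff {N : ℕ} {v : List ℕ} (t : L.Term (Empty ⊕ Fin v.length))
    (i : Fin N) : i ∈ t.realize (Sum.elim default (assignment N v)) ↔ termTruth i v t := by
  rw [termTruth_iff, ← Set.singleton_subset_iff,
    le_realize_iff_of_isAtom (Set.isAtom_singleton i)]
  refine iff_of_eq (congrArg (t.realize ·) (funext fun j => ?_))
  rcases j with j | j
  · exact j.elim
  · simp [assignment, bits]

section FormulaTruth

open Classical in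
/-- The truth value of a formula in the algebra of subsets of `Fin N`. -/
noncomputable def formulaTruth (N : ℕ) (v : List ℕ) (φ : L.BoundedFormula Empty v.length) : Bool :=
  decide (φ.Realize default (assignment N v))

variable {N : ℕ} {v : List ℕ}

theorem formulaTruth_iff (φ : L.BoundedFormula Empty v.length) :
    formulaTruth N v φ ↔ φ.Realize default (assignment N v) := by
  classical exact decide_eq_true_iff

theorem formulaTruth_falsum : formulaTruth N v .falsum = false := by
  rw [← Bool.not_eq_true, formulaTruth_iff]
  exact id

theorem formulaTruth_equal (s t : L.Term (Empty ⊕ Fin v.length)) :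
    formulaTruth N v (.equal s t) = decide (∀ i < N, termTruth i v s = termTruth i v t) := by
  rw [Bool.eq_iff_iff, formulaTruth_iff, decide_eq_true_iff]
  simp only [BoundedFormula.Realize, Set.ext_iff, mem_realize_assignment_iff, Fin.forall_iff,
    ← Bool.eq_iff_iff]

theorem formulaTruth_rel (n : ℕ+) (t : L.Term (Empty ⊕ Fin v.length)) :
    formulaTruth N v (.rel (Rel.C n) ![t]) =
      decide ((n : ℕ) ≤ ((List.range N).filter (termTruth · v t)).length) := by
  rw [Bool.eq_iff_iff, formulaTruth_iff, decide_eq_true_iff, ← Nat.cast_le (α := ℕ∞),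
    ← encard_setOf_fin]
  simp only [← mem_realize_assignment_iff]
  exact iff_of_eq (congrArg (_ ≤ ·) (encard_atomsBelow_set _))

theorem formulaTruth_imp (φ ψ : L.BoundedFormula Empty v.length) :
    formulaTruth N v (.imp φ ψ) = (!formulaTruth N v φ || formulaTruth N v ψ) := by
  rw [Bool.eq_iff_iff, Bool.or_eq_true, Bool.not_eq_true', ← Bool.not_eq_true,
    ← imp_iff_not_or, formulaTruth_iff, formulaTruth_iff, formulaTruth_iff,
    BoundedFormula.realize_imp]

theorem formulaTruth_all (φ : L.BoundedFormula Empty (v.length + 1)) :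
    formulaTruth N v (.all φ) = decide (∀ x < 2 ^ N, formulaTruth N (x :: v) φ) := by
  rw [Bool.eq_iff_iff, formulaTruth_iff, decide_eq_true_iff]
  simp only [BoundedFormula.realize_all, forall_bits_iff, formulaTruth_iff, assignment_cons]

theorem formulaTruth_nil_iff (φ : L.Sentence) :
    formulaTruth N [] φ ↔ φ.Realize (Set (Fin N)) :=
  (formulaTruth_iff _).trans <| iff_of_eq <| congrArg₂ (BoundedFormula.Realize φ)
    (Subsingleton.elim _ _) (Subsingleton.elim (α := Fin 0 → Set (Fin N)) _ _)

end FormulaTruth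

/-- The truth value of the formula with code `c` in the algebra of subsets of `Fin N` under the
assignment coded by `v`, as a function of the triple `(N, v, c)`. -/
noncomputable def formulaVal (x : ℕ × List ℕ × ℕ) : Option Bool :=
  valOfCode formulaCode (formulaTruth x.1 x.2.1) x.2.2

section AtomicAndAll

variable {N m n : ℕ} {v : List ℕ} {b : Bool}

theorem exists_formulaTruth_equal_eq_iff :
    (∃ s t, (termCode s = m ∧ termCode t = n) ∧ formulaTruth N v (.equal s t) = b) ↔
      Option.map₂ (fun _ _ => decide (∀ i < N, termVal i v m = termVal i v n))
        (termVal 0 v m) (termVal 0 v n) = some b := by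
  simp only [termVal]
  rw [map₂_valOfCode_eq_some_iff termCode_injective]
  refine exists₂_congr fun s t => and_congr_right ?_
  rintro ⟨rfl, rfl⟩
  simp only [formulaTruth_equal, valOfCode_apply termCode_injective, Option.some_inj]

theorem exists_formulaTruth_rel_eq_iff :
    (∃ (k : ℕ+) (t : _), ((k : ℕ) = m ∧ termCode t = n) ∧
        formulaTruth N v (.rel (Rel.C k) ![t]) = b) ↔
      m ≠ 0 ∧ (termVal 0 v n).map (fun _ =>
        decide (m ≤ ((List.range N).filter (termVal · v n = some true)).length)) = some b := by
  rw [termVal, map_valOfCode_eq_some_iff termCode_injective]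
  constructor
  · rintro ⟨k, t, ⟨rfl, rfl⟩, h⟩
    refine ⟨k.ne_zero, t, rfl, ?_⟩
    simpa [formulaTruth_rel, termVal, valOfCode_apply termCode_injective] using h
  · rintro ⟨hm, t, rfl, h⟩
    lift m to ℕ+ using Nat.pos_of_ne_zero hm
    refine ⟨m, t, ⟨rfl, rfl⟩, ?_⟩
    simpa [formulaTruth_rel, termVal, valOfCode_apply termCode_injective] using h

theorem exists_formulaTruth_all_eq_iff :
    (∃ φ, formulaCode φ = n ∧ formulaTruth N v (.all φ) = b) ↔
      (formulaVal (N, 0 :: v, n)).map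
        (fun _ => decide (∀ x < 2 ^ N, formulaVal (N, x :: v, n) = some true)) = some b := by
  simp only [formulaVal]
  rw [map_valOfCode_eq_some_iff formulaCode_injective]
  refine exists_congr fun φ => and_congr_right ?_
  rintro rfl
  simp only [formulaTruth_all, valOfCode_apply formulaCode_injective, Option.some_inj]

end AtomicAndAll

/-- The arguments of the recursive calls in the evaluation of a formula: for an implication its two
sides, and for a universal quantifier its scope under every value of the new variable. -/
def formulaCalls (x : ℕ × List ℕ × ℕ) : List (ℕ × List ℕ × ℕ) :=
  let p := x.2.2.unpair.2
  [ [], [], [], [(x.1, x.2.1, p.unpair.1), (x.1, x.2.1, p.unpair.2)],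
    (List.range (2 ^ x.1)).map fun y => (x.1, y :: x.2.1, p)].getD x.2.2.unpair.1 []

/-- The value of `formulaVal` at `x`, computed from the list `l` of its values at
`formulaCalls x`. -/
noncomputable def formulaStep (x : ℕ × List ℕ × ℕ) (l : List (Option Bool)) : Option Bool :=
  let p := x.2.2.unpair.2
  let val (i n : ℕ) : Option Bool := termVal i x.2.1 n
  [if p = 0 then some false else none,
    Option.map₂ (fun _ _ => decide (∀ i < x.1, val i p.unpair.1 = val i p.unpair.2))
      (val 0 p.unpair.1) (val 0 p.unpair.2),
    if p.unpair.1 = 0 then none else (val 0 p.unpair.2).map fun _ =>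
      decide (p.unpair.1 ≤ ((List.range x.1).filter (val · p.unpair.2 = some true)).length),
    Option.map₂ (fun a b => !a || b) (l.getD 0 none) (l.getD 1 none),
    (l.getD 0 none).map fun _ => decide (∀ b ∈ l, b = some true)].getD x.2.2.unpair.1 none

theorem lt_of_mem_formulaCalls {x y : ℕ × List ℕ × ℕ} (h : y ∈ formulaCalls x) :
    y.2.2 < x.2.2 := by
  obtain ⟨N, v, n⟩ := x
  obtain ⟨a, p, rfl⟩ : ∃ a p, n = Nat.pair a p := ⟨_, _, (Nat.pair_unpair n).symm⟩
  rw [formulaCalls, Nat.unpair_pair] at h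
  match a with
  | 0 | 1 | 2 => simp at h
  | 3 =>
    obtain ⟨q, r, rfl⟩ : ∃ q r, p = Nat.pair q r := ⟨_, _, (Nat.pair_unpair p).symm⟩
    rw [Nat.unpair_pair] at h
    obtain rfl | rfl : y = (N, v, q) ∨ y = (N, v, r) := by simpa using h
    · exact lt_pair_pair_left (by simp)
    · exact lt_pair_pair_right (by simp)
  | 4 =>
    obtain ⟨x, -, rfl⟩ : ∃ x < 2 ^ N, (N, x :: v, p) = y := by simpa using h
    exact lt_pair_right (by simp)
  | a + 5 => simp at h

theorem formulaVal_eq_formulaStep (x : ℕ × List ℕ × ℕ) :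
    formulaVal x = formulaStep x ((formulaCalls x).map formulaVal) := by
  obtain ⟨N, v, n⟩ := x
  obtain ⟨a, p, rfl⟩ : ∃ a p, n = Nat.pair a p := ⟨_, _, (Nat.pair_unpair n).symm⟩
  obtain ⟨q, r, hp⟩ : ∃ q r, p = Nat.pair q r := ⟨_, _, (Nat.pair_unpair p).symm⟩
  ext b
  rw [formulaVal, valOfCode_eq_some_iff formulaCode_injective, exists_formula_iff]
  simp only [formulaCode, formulaTruth_falsum, formulaTruth_imp, formulaStep, formulaCalls,
    Nat.unpair_pair, Nat.pair_eq_pair]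
  match a with
  | 0 => by_cases h : p = 0 <;> simp [h, eq_comm (a := 0)]
  | 1 => simpa [hp, -Option.map₂_eq_some_iff] using exists_formulaTruth_equal_eq_iff
  | 2 => simpa [hp, -Option.map_eq_some_iff] using exists_formulaTruth_rel_eq_iff
  | 3 =>
    simp [hp, formulaVal, map₂_valOfCode_eq_some_iff formulaCode_injective,
      -Option.map₂_eq_some_iff]
  | 4 => simpa [hp, -Option.map_eq_some_iff] using exists_formulaTruth_all_eq_iff
  | a + 5 => simp

end Evaluation

section Computability

theorem primrec_two_pow : Primrec fun n : ℕ => 2 ^ n :=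
  (Primrec₂.unpaired'.1 Nat.Primrec.pow).comp (Primrec.const 2) Primrec.id

theorem primrec_testBit : Primrec₂ Nat.testBit := by
  have : PrimrecPred fun p : ℕ × ℕ => p.1 / 2 ^ p.2 % 2 = 1 :=
    Primrec.eq.comp (Primrec.nat_mod.comp
      (Primrec.nat_div.comp Primrec.fst (primrec_two_pow.comp Primrec.snd)) (Primrec.const 2))
      (Primrec.const 1)
  exact this.decide.of_eq fun p => Nat.testBit_eq_decide_div_mod_eq.symm

variable {α β γ σ : Type*} [Primcodable α] [Primcodable β] [Primcodable γ] [Primcodable σ]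

theorem primrec_option_map_const {f : α → Option β} {g : α → σ} (hf : Primrec f)
    (hg : Primrec g) : Primrec fun a => (f a).map fun _ => g a :=
  Primrec.option_map hf (hg.comp Primrec.fst).to₂

theorem primrec_option_map₂ {g : α → β → γ → σ} {f₁ : α → Option β} {f₂ : α → Option γ}
    (hg : Primrec₂ fun a (p : β × γ) => g a p.1 p.2) (h₁ : Primrec f₁) (h₂ : Primrec f₂) :
    Primrec fun a => Option.map₂ (g a) (f₁ a) (f₂ a) :=
  Primrec.option_bind h₁ (Primrec.option_map (h₂.comp Primrec.fst)
    (hg.comp (Primrec.fst.comp Primrec.fst)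
      ((Primrec.snd.comp Primrec.fst).pair Primrec.snd)).to₂).to₂

theorem primrec_option_map₂_bool {f₁ f₂ : α → Option Bool} (g : Bool → Bool → Bool)
    (h₁ : Primrec f₁) (h₂ : Primrec f₂) : Primrec fun a => Option.map₂ g (f₁ a) (f₂ a) :=
  primrec_option_map₂ ((Primrec.dom_bool₂ g).comp
    (Primrec.fst.comp Primrec.snd) (Primrec.snd.comp Primrec.snd)).to₂ h₁ h₂

theorem primrec_unpair_fst {f : α → ℕ} (h : Primrec f) : Primrec fun a => (f a).unpair.1 :=
  Primrec.fst.comp (Primrec.unpair.comp h)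

theorem primrec_unpair_snd {f : α → ℕ} (h : Primrec f) : Primrec fun a => (f a).unpair.2 :=
  Primrec.snd.comp (Primrec.unpair.comp h)

theorem primrec_termStep :
    Primrec₂ fun (x : ℕ × List ℕ) (l : List (Option Bool)) => termStep x.1 x.2 l := by
  have hlength : Primrec fun x : (ℕ × List ℕ) × List (Option Bool) => x.2.length :=
    Primrec.list_length.comp Primrec.snd
  have harg := primrec_unpair_snd hlength
  have hrec {f : (ℕ × List ℕ) × List (Option Bool) → ℕ} (hf : Primrec f) :
      Primrec fun x : (ℕ × List ℕ) × List (Option Bool) => x.2.getD (f x) none :=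
    (Primrec.list_getD none).comp Primrec.snd hf
  have hzero (b : Bool) : Primrec fun x : (ℕ × List ℕ) × List (Option Bool) =>
      if x.2.length.unpair.2 = 0 then some b else none :=
    Primrec.ite (Primrec.eq.comp harg (.const 0)) (.const _) (.const _)
  have hvar : Primrec fun x : (ℕ × List ℕ) × List (Option Bool) =>
      x.1.2.reverse[x.2.length.unpair.2]?.map (Nat.testBit · x.1.1) :=
    Primrec.option_map (Primrec.list_getElem?.comp
        (Primrec.list_reverse.comp (Primrec.snd.comp Primrec.fst)) harg)
      (primrec_testBit.comp Primrec.snd (Primrec.fst.comp (Primrec.fst.comp Primrec.fst)))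
  have hleft := hrec (primrec_unpair_fst harg)
  have hright := hrec (primrec_unpair_snd harg)
  exact (Primrec.list_getD none).comp
    (Primrec.list_cons.comp hvar <| Primrec.list_cons.comp (hzero false) <|
      Primrec.list_cons.comp (hzero true) <|
      Primrec.list_cons.comp ((Primrec.dom_finite (Option.map not)).comp (hrec harg)) <|
      Primrec.list_cons.comp (primrec_option_map₂_bool and hleft hright) <|
      Primrec.list_cons.comp (primrec_option_map₂_bool or hleft hright) <| Primrec.const [])
    (primrec_unpair_fst hlength)

theorem primrec_termVal : Primrec₂ fun (x : ℕ × List ℕ) (n : ℕ) => termVal x.1 x.2 n :=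
  Primrec.nat_strong_rec _ (Primrec.option_some.comp primrec_termStep).to₂
    fun x n => congrArg some (termVal_eq_termStep x.1 x.2 n).symm

theorem primrec_formulaCalls : Primrec formulaCalls := by
  have hN : Primrec fun x : ℕ × List ℕ × ℕ => x.1 := Primrec.fst
  have hv : Primrec fun x : ℕ × List ℕ × ℕ => x.2.1 := Primrec.fst.comp Primrec.snd
  have hn : Primrec fun x : ℕ × List ℕ × ℕ => x.2.2 := Primrec.snd.comp Primrec.snd
  have harg := primrec_unpair_snd hn
  have himp : Primrec fun x : ℕ × List ℕ × ℕ =>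
      [(x.1, x.2.1, x.2.2.unpair.2.unpair.1), (x.1, x.2.1, x.2.2.unpair.2.unpair.2)] :=
    Primrec.list_cons.comp (hN.pair (hv.pair (primrec_unpair_fst harg)))
      (Primrec.list_cons.comp (hN.pair (hv.pair (primrec_unpair_snd harg))) (Primrec.const []))
  have hall : Primrec fun x : ℕ × List ℕ × ℕ =>
      (List.range (2 ^ x.1)).map fun y => (x.1, y :: x.2.1, x.2.2.unpair.2) :=
    Primrec.list_map (Primrec.list_range.comp (primrec_two_pow.comp hN))
      ((hN.comp Primrec.fst).pair ((Primrec.list_cons.comp Primrec.snd (hv.comp Primrec.fst)).pair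
        (harg.comp Primrec.fst)))
  exact (Primrec.list_getD []).comp
    (Primrec.list_cons.comp (Primrec.const []) <| Primrec.list_cons.comp (Primrec.const []) <|
      Primrec.list_cons.comp (Primrec.const []) <| Primrec.list_cons.comp himp <|
      Primrec.list_cons.comp hall <| Primrec.const [])
    (primrec_unpair_fst hn)

theorem primrec_decide_forall_termVal_eq : Primrec fun x : ℕ × List ℕ × ℕ × ℕ =>
    decide (∀ i < x.1, termVal i x.2.1 x.2.2.1 = termVal i x.2.1 x.2.2.2) := by
  have hval {f : ℕ × List ℕ × ℕ × ℕ → ℕ} (hf : Primrec f) :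
      Primrec₂ fun (i : ℕ) (x : ℕ × List ℕ × ℕ × ℕ) => termVal i x.2.1 (f x) :=
    primrec_termVal.comp
      (Primrec.fst.pair (Primrec.fst.comp (Primrec.snd.comp Primrec.snd))) (hf.comp Primrec.snd)
  have heq : PrimrecRel fun (i : ℕ) (x : ℕ × List ℕ × ℕ × ℕ) =>
      termVal i x.2.1 x.2.2.1 = termVal i x.2.1 x.2.2.2 :=
    Primrec.eq.comp (hval (Primrec.fst.comp (Primrec.snd.comp Primrec.snd)))
      (hval (Primrec.snd.comp (Primrec.snd.comp Primrec.snd)))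
  exact ((heq.forall_mem_list.comp (Primrec.list_range.comp Primrec.fst) Primrec.id).of_eq
    (by simp)).decide

theorem primrec_length_filter_termVal : Primrec fun x : ℕ × List ℕ × ℕ =>
    ((List.range x.1).filter (termVal · x.2.1 x.2.2 = some true)).length := by
  have htrue : PrimrecRel fun (i : ℕ) (x : ℕ × List ℕ × ℕ) => termVal i x.2.1 x.2.2 = some true :=
    Primrec.eq.comp (primrec_termVal.comp
      (Primrec.fst.pair (Primrec.fst.comp (Primrec.snd.comp Primrec.snd)))
      (Primrec.snd.comp (Primrec.snd.comp Primrec.snd))) (Primrec.const _)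
  exact Primrec.list_length.comp
    (htrue.listFilter.comp (Primrec.list_range.comp Primrec.fst) Primrec.id)

theorem primrec_formulaStep : Primrec₂ formulaStep := by
  have hN : Primrec fun x : (ℕ × List ℕ × ℕ) × List (Option Bool) => x.1.1 :=
    Primrec.fst.comp Primrec.fst
  have hv : Primrec fun x : (ℕ × List ℕ × ℕ) × List (Option Bool) => x.1.2.1 :=
    Primrec.fst.comp (Primrec.snd.comp Primrec.fst)
  have hn : Primrec fun x : (ℕ × List ℕ × ℕ) × List (Option Bool) => x.1.2.2 :=
    Primrec.snd.comp (Primrec.snd.comp Primrec.fst)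
  have harg := primrec_unpair_snd hn
  have hp := primrec_unpair_fst harg
  have hq := primrec_unpair_snd harg
  have hval {f : (ℕ × List ℕ × ℕ) × List (Option Bool) → ℕ} (hf : Primrec f) :
      Primrec fun x : (ℕ × List ℕ × ℕ) × List (Option Bool) => termVal 0 x.1.2.1 (f x) :=
    primrec_termVal.comp ((Primrec.const 0).pair hv) hf
  have hrec (k : ℕ) : Primrec fun x : (ℕ × List ℕ × ℕ) × List (Option Bool) => x.2.getD k none :=
    (Primrec.list_getD none).comp Primrec.snd (Primrec.const k)
  have hfalsum : Primrec fun x : (ℕ × List ℕ × ℕ) × List (Option Bool) =>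
      if x.1.2.2.unpair.2 = 0 then some false else none :=
    Primrec.ite (Primrec.eq.comp harg (.const 0)) (.const _) (.const _)
  have hequal := primrec_decide_forall_termVal_eq.comp (hN.pair (hv.pair (hp.pair hq)))
  have hrel := Primrec.ite (Primrec.eq.comp hp (.const 0)) (.const none) <|
    primrec_option_map_const (hval hq) (Primrec.nat_le.comp hp
      (primrec_length_filter_termVal.comp (hN.pair (hv.pair hq)))).decide
  have hall := primrec_option_map_const (hrec 0) ((PrimrecPred.forall_mem_list
    (Primrec.eq.comp Primrec.id (.const (some true)))).comp Primrec.snd).decide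
  exact (Primrec.list_getD none).comp
    (Primrec.list_cons.comp hfalsum <| Primrec.list_cons.comp
      (primrec_option_map₂ (hequal.comp Primrec.fst).to₂ (hval hp) (hval hq)) <|
      Primrec.list_cons.comp hrel <|
      Primrec.list_cons.comp (primrec_option_map₂_bool (fun a b => !a || b) (hrec 0) (hrec 1)) <|
      Primrec.list_cons.comp hall <| Primrec.const [])
    (primrec_unpair_fst hn)

theorem computable_formulaVal : Computable formulaVal :=
  computable_of_recursive_calls (measure fun x : ℕ × List ℕ × ℕ => x.2.2).wf
    (fun _ _ => lt_of_mem_formulaCalls) primrec_formulaCalls.to_comp primrec_formulaStep.to_comp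
    formulaVal_eq_formulaStep

theorem weight_le_two_pow_formulaCode {m : ℕ} (φ : L.BoundedFormula Empty m) :
    weight φ ≤ 2 ^ formulaCode φ := by
  induction φ with
  | falsum => simp [weight]
  | equal s t => exact Nat.one_le_two_pow
  | rel R ts =>
    obtain ⟨n⟩ := R
    exact (lt_pair_pair_left (by simp)).le.trans Nat.lt_two_pow_self.le
  | imp φ ψ hφ hψ =>
    refine max_le (hφ.trans ?_) (hψ.trans ?_)
    · exact Nat.pow_le_pow_right (by simp) (lt_pair_pair_left (by simp)).le
    · exact Nat.pow_le_pow_right (by simp) (lt_pair_pair_right (by simp)).le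
  | all φ ih =>
    rw [weight]
    refine (Nat.mul_le_mul_left 2 ih).trans ?_
    rw [← pow_succ']
    exact Nat.pow_le_pow_right (by simp) (lt_pair_right (by simp))

theorem theoryInfAtomic_models_iff_realize_fin (φ : L.Sentence) :
    theoryInfAtomic.{u} ⊨ᵇ φ ↔ φ.Realize (Set (Fin (2 ^ formulaCode φ))) := by
  rw [theoryInfAtomic_models_iff]
  refine realize_sentence_iff_of_le_encard φ (by simp [encard_isAtom_eq_top]) ?_
  have hatoms := encard_atomsBelow_set (Set.univ : Set (Fin (2 ^ formulaCode φ)))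
  simp only [atomsBelow, Set.subset_univ, and_true, Set.encard_univ,
    ENat.card_eq_coe_fintype_card, Fintype.card_fin] at hatoms
  rw [hatoms]
  exact_mod_cast weight_le_two_pow_formulaCode φ

theorem exists_models_iff_formulaVal (c : ℕ) :
    (∃ φ : L.Sentence, formulaCode φ = c ∧ theoryInfAtomic.{u} ⊨ᵇ φ) ↔
      formulaVal (2 ^ c, [], c) = some true := by
  rw [formulaVal, valOfCode_eq_some_iff formulaCode_injective]
  refine exists_congr fun φ => and_congr_right ?_
  rintro rfl
  rw [theoryInfAtomic_models_iff_realize_fin]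
  exact (formulaTruth_nil_iff φ).symm

theorem isDecidable_theoryInfAtomic : IsDecidable theoryInfAtomic.{u} := by
  have h : Computable fun c : ℕ => decide (formulaVal (2 ^ c, [], c) = some true) :=
    Primrec.eq.decide.to_comp.comp (computable_formulaVal.comp
      (primrec_two_pow.to_comp.pair ((Computable.const []).pair Computable.id)))
      (Computable.const _)
  refine ComputablePred.computable_iff.2 ⟨_, h, funext fun c => ?_⟩
  rw [exists_models_iff_formulaVal, decide_eq_true_eq]

end Computability

end BoolAtoms

theorem theorem1 :
    BoolAtoms.theoryInfAtomic.{u}.IsComplete ∧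
    BoolAtoms.IsDecidable BoolAtoms.theoryInfAtomic.{u} ∧
    BoolAtoms.HasQuantifierElimination BoolAtoms.theoryInfAtomic.{u} ∧
    BoolAtoms.IsAxiomatizedBy BoolAtoms.theoryInfAtomic.{u} BoolAtoms.axiomsInfAtomic ∧
    (∀ (M : Type u) (S : BoolAtoms.L.Structure M),
      M ⊨ BoolAtoms.axiomsInfAtomic ↔
        Infinite M ∧ ∃ _ : BooleanAlgebra M, IsAtomic M ∧ S = BoolAtoms.structureOf M) :=
  ⟨BoolAtoms.isComplete_theoryInfAtomic, BoolAtoms.isDecidable_theoryInfAtomic,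
    BoolAtoms.hasQuantifierElimination_theoryInfAtomic,
    BoolAtoms.isAxiomatizedBy_axiomsInfAtomic, fun _ => BoolAtoms.model_axiomsInfAtomic_iff⟩
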